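/- **Conventions.** A diffeological vector pseudo-bundle is a smooth surjection $\pi:V\to X$ of diffeological spaces with a real vector space structure on each fibre $\pi^{-1}(x)$ such that fibrewise addition $V\times_XV\to V$, scalar multiplication $\mathbb R\times V\to V$ and the zero section $X\to V$ are smooth. It is locally trivial if every point of $X$ has a D-open neighbourhood $U$ with a fibrewise linear diffeomorphism $\pi^{-1}(U)\cong U\times F$ over $U$, where $F$ is a diffeological vector space. Its dual pseudo-bundle is $V^*=\bigcup_{x\in X}(\pi^{-1}(x))^*$, where $(\pi^{-1}(x))^*$ is the space of smooth linear maps $\pi^{-1}(x)\to\mathbb R$, with projection $\pi^*:V^*\to X$. A map $q:U'\to V^*$ is a plot if and only if $\pi^*\circ q$ is a plot of $X$ and, for every plot $p:U\to V$, the evaluation $(u',u)\mapsto q(u')(p(u))$ is smooth on $\{(u',u)\mid \pi^*(q(u'))=\pi(p(u))\}$ with the subset diffeology. If the fibres are finite-dimensional, a pseudo-metric on $V$ is a smooth section $g$ of $V^*\otimes V^*$ such that each $g(x)$ is a symmetric positive semi-definite bilinear form on $\pi^{-1}(x)$ of rank $\dim(\pi^{-1}(x))^*$. It induces a form $g^*(x)$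 on $(\pi^{-1}(x))^*$ by $g^*(x)\big(g(x)(v,\cdot),g(x)(w,\cdot)\big)=g(x)(v,w)$. For $f:X_1\supseteq Y\to X_2$, the gluing $X_1\cup_fX_2$ is the quotient of $X_1\sqcup X_2$ by the equivalence relation generated by $y\sim f(y)$, $y\in Y$, with the quotient diffeology. A gluing of $\pi_1:V_1\to X_1$ to $\pi_2:V_2\to X_2$ along $(\tilde f,f)$ is given by a smooth $f:X_1\supseteq Y\to X_2$ and a smooth fibrewise linear lift $\tilde f:\pi_1^{-1}(Y)\to V_2$ of $f$; it yields $\pi_1\cup_{(\tilde f,f)}\pi_2:V_1\cup_{\tilde f}V_2\to X_1\cup_fX_2$. We write $i_1,i_2$ for the natural maps of the left and right term of a glued base space ($i_1$ restricted to the complement of the gluing domain) and $j_1,j_2$ for those of a glued total space. The gluing is invertible if $f$ is a diffeomorphism of $Y$ with $f(Y)$ (subset diffeologies). Then $\tilde f^*:(\pi_2^*)^{-1}(f(Y))\to V_1^*$, $\tilde f^*(\varphi)=\varphi\circ\tilde f|_{\pi_1^{-1}(f^{-1}(x))}$ for $\varphi\in(\pi_2^{-1}(x))^*$, and $f^{-1}$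 define a gluing $V_2^*\cup_{\tilde f^*}V_1^*\to X_2\cup_{f^{-1}}X_1$ of $V_2^*$ to $V_1^*$. The switch map $X_1\cup_fX_2\to X_2\cup_{f^{-1}}X_1$ is induced by interchanging the two terms. **Theorem.** Let $\pi_1:V_1\to X_1$ and $\pi_2:V_2\to X_2$ be locally trivial diffeological vector pseudo-bundles with finite-dimensional fibres, and let $(\tilde f,f)$ be an invertible gluing of $V_1$ to $V_2$. Let $g_1,g_2$ be pseudo-metrics on $V_1,V_2$ compatible with the gluing, i.e. $g_1(y)(v,w)=g_2(f(y))(\tilde f(v),\tilde f(w))$ for all $y\in Y$ and $v,w\in\pi_1^{-1}(y)$. Assume that the induced dual pseudo-metrics are compatible with the gluing along $(\tilde f^*,f^{-1})$, i.e. $g_1^*(f^{-1}(x))(\tilde f^*\varphi,\tilde f^*\psi)=g_2^*(x)(\varphi,\psi)$ for all $x\in f(Y)$ and $\varphi,\psi\in(\pi_2^{-1}(x))^*$. Then $V_1$, $V_2$ and $(\tilde f,f)$ satisfy the gluing-dual commutativity condition: there is a diffeomorphism $$\Phi_{\cup,*}:(V_1\cup_{\tilde f}V_2)^*\to V_2^*\cup_{\tilde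 f^*}V_1^*$$ covering the switch map and equal to - $j_2^{V_1^*}\circ(j_1^{V_1})^*$ over $i_1(X_1\setminus Y)$, - $j_2^{V_1^*}\circ\tilde f^*\circ(j_2^{V_2})^*$ over $i_2(f(Y))$, - $j_1^{V_2^*}\circ(j_2^{V_2})^*$ over $i_2(X_2\setminus f(Y))$. -/

import Mathlib

open Diffeology
open scoped ContDiff TensorProduct Topology

noncomputable section

/-! ## Diffeological constructions -/

/-- The standard domain `ℝⁿ` on which plots are defined. -/
abbrev Eucl (n : ℕ) : Type := EuclideanSpace ℝ (Fin n)

/-- Near a given point of an open set, the identity agrees with a smooth map into that set. -/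
theorem exists_smooth_cutoff {n : ℕ} {u : Set (Eucl n)} (hu : IsOpen u) {x : Eucl n}
    (hx : x ∈ u) :
    ∃ c : Eucl n → Eucl n, ContDiff ℝ ∞ c ∧ (∀ y, c y ∈ u) ∧ ∀ᶠ y in nhds x, c y = y := by
  obtain ⟨ε, hε, hball⟩ := Metric.isOpen_iff.mp hu x hx
  let χ : ContDiffBump x := ⟨ε / 2, ε, by positivity, by linarith⟩
  refine ⟨fun y => x + χ y • (y - x), ?_, ?_, ?_⟩
  · exact contDiff_const.add (χ.contDiff.smul (contDiff_id.sub contDiff_const))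
  · intro y
    apply hball
    by_cases hy : y ∈ Metric.ball x ε
    · rw [Metric.mem_ball, dist_eq_norm] at hy ⊢
      have h1 : ‖χ y • (y - x)‖ ≤ ‖y - x‖ := by
        rw [norm_smul, Real.norm_of_nonneg χ.nonneg]
        exact mul_le_of_le_one_left (norm_nonneg _) χ.le_one
      simpa using lt_of_le_of_lt h1 hy
    · have : χ y = 0 := χ.zero_of_le_dist (by simpa [Metric.mem_ball] using hy)
      simpa [this] using hε
  · filter_upwards [χ.eventuallyEq_one] with y hy
    simp [hy]

/-- The diffeology whose plots are the maps that locally agree with members of a family `A`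
of maps containing the constants and closed under smooth reparametrisation (that is, the
diffeology generated by `A`). -/
@[reducible]
def DiffeologicalSpace.ofLocal {X : Type*} (A : ∀ n, Set (Eucl n → X))
    (hconst : ∀ (n : ℕ) (x : X), (fun _ => x) ∈ A n)
    (hcomp : ∀ {n m : ℕ} {p : Eucl m → X} {f : Eucl n → Eucl m}, p ∈ A m → ContDiff ℝ ∞ f →
      p ∘ f ∈ A n) : DiffeologicalSpace X where
  plots n := {p | ∀ x, ∃ q ∈ A n, ∀ᶠ y in nhds x, p y = q y}
  constant_plots x := fun _ => ⟨_, hconst _ x, Filter.Eventually.of_forall fun _ => rfl⟩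
  plot_reparam := by
    intro n m p f hp hf x
    obtain ⟨q, hq, h⟩ := hp (f x)
    exact ⟨q ∘ f, hcomp hq hf, hf.continuous.continuousAt.eventually h⟩
  locality := by
    intro n p hp x
    obtain ⟨u, hu, hxu, h⟩ := hp x
    obtain ⟨c, hc, hcu, hcx⟩ := exists_smooth_cutoff hu hxu
    obtain ⟨q, hq, hpq⟩ := h hcu hc x
    refine ⟨q, hq, ?_⟩
    filter_upwards [hpq, hcx] with y h1 h2
    rw [← h1, Function.comp_apply, h2]

/-- The subset diffeology. -/
instance Subtype.instDiffeologicalSpace {X : Type*} [DiffeologicalSpace X] (s : X → Prop) :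
    DiffeologicalSpace (Subtype s) where
  plots n := {p | IsPlot (fun u => (p u : X))}
  constant_plots x := isPlot_const
  plot_reparam hp hf := isPlot_reparam hp hf
  locality {n p} hp := DiffeologicalSpace.locality (X := X) fun x => by
    obtain ⟨u, hu, hxu, h⟩ := hp x
    exact ⟨u, hu, hxu, fun {m f} h1 h2 => h h1 h2⟩

/-- The product diffeology. -/
instance Prod.instDiffeologicalSpace {X Y : Type*} [DiffeologicalSpace X]
    [DiffeologicalSpace Y] : DiffeologicalSpace (X × Y) where
  plots n := {p | IsPlot (fun u => (p u).1) ∧ IsPlot (fun u => (p u).2)}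
  constant_plots x := ⟨isPlot_const, isPlot_const⟩
  plot_reparam hp hf := ⟨isPlot_reparam hp.1 hf, isPlot_reparam hp.2 hf⟩
  locality {n p} hp :=
    ⟨DiffeologicalSpace.locality (X := X) fun x => by
      obtain ⟨u, hu, hxu, h⟩ := hp x
      exact ⟨u, hu, hxu, fun {m f} h1 h2 => (h h1 h2).1⟩,
    DiffeologicalSpace.locality (X := Y) fun x => by
      obtain ⟨u, hu, hxu, h⟩ := hp x
      exact ⟨u, hu, hxu, fun {m f} h1 h2 => (h h1 h2).2⟩⟩

/-- The disjoint union diffeology: locally, a plot is a plot of one of the two terms. -/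
instance Sum.instDiffeologicalSpace {X Y : Type*} [DiffeologicalSpace X]
    [DiffeologicalSpace Y] : DiffeologicalSpace (X ⊕ Y) :=
  DiffeologicalSpace.ofLocal
    (fun n => {p | (∃ q : Eucl n → X, IsPlot q ∧ p = Sum.inl ∘ q) ∨
      ∃ q : Eucl n → Y, IsPlot q ∧ p = Sum.inr ∘ q})
    (fun _ x => by
      rcases x with x | x
      · exact Or.inl ⟨fun _ => x, isPlot_const, rfl⟩
      · exact Or.inr ⟨fun _ => x, isPlot_const, rfl⟩)
    (by
      rintro n m p f (⟨q, hq, rfl⟩ | ⟨q, hq, rfl⟩) hf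
      · exact Or.inl ⟨q ∘ f, isPlot_reparam hq hf, rfl⟩
      · exact Or.inr ⟨q ∘ f, isPlot_reparam hq hf, rfl⟩)

/-- The pushforward of a diffeology by a surjective map: locally, a plot lifts to a plot. -/
@[reducible]
def DiffeologicalSpace.pushforward {X Y : Type*} [DiffeologicalSpace X] (F : X → Y)
    (hF : Function.Surjective F) : DiffeologicalSpace Y :=
  DiffeologicalSpace.ofLocal (fun n => {p | ∃ q : Eucl n → X, IsPlot q ∧ p = F ∘ q})
    (fun _ y => by
      obtain ⟨x, rfl⟩ := hF y
      exact ⟨fun _ => x, isPlot_const, rfl⟩)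
    (by
      rintro n m p f ⟨q, hq, rfl⟩ hf
      exact ⟨q ∘ f, isPlot_reparam hq hf, rfl⟩)

/-! ## Gluing of diffeological spaces -/

section Glue

variable {X₁ X₂ : Type*} {Y : Set X₁}

/-- The identification `y ∼ f y`, for `y ∈ Y`, on the disjoint union of `X₁` and `X₂`. -/
inductive GlueRel (f : Y → X₂) : X₁ ⊕ X₂ → X₁ ⊕ X₂ → Prop
  | glue (y : Y) : GlueRel f (Sum.inl y) (Sum.inr (f y))

/-- The gluing `X₁ ∪_f X₂` of `X₁` to `X₂` along `f : X₁ ⊇ Y → X₂`: the quotient of the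
disjoint union by the equivalence relation generated by `GlueRel f`. -/
def Glue (f : Y → X₂) : Type _ := Quot (GlueRel f)

/-- The natural map `X₁ → X₁ ∪_f X₂`; its restriction to `X₁ \ Y` is the inclusion `i₁`
(`j₁` on total spaces). -/
def Glue.inl (f : Y → X₂) (x : X₁) : Glue f := Quot.mk _ (Sum.inl x)

/-- The natural inclusion `i₂ : X₂ → X₁ ∪_f X₂` (`j₂` on total spaces). -/
def Glue.inr (f : Y → X₂) (x : X₂) : Glue f := Quot.mk _ (Sum.inr x)

theorem Glue.inl_eq_inr (f : Y → X₂) (y : Y) : Glue.inl f y = Glue.inr f (f y) :=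
  Quot.sound (GlueRel.glue y)

/-- The gluing diffeology: the pushforward of the disjoint union diffeology. -/
instance Glue.instDiffeologicalSpace [DiffeologicalSpace X₁] [DiffeologicalSpace X₂]
    (f : Y → X₂) : DiffeologicalSpace (Glue f) :=
  DiffeologicalSpace.pushforward (Quot.mk (GlueRel f)) Quot.mk_surjective

open Classical in
/-- As a set, `X₁ ∪_f X₂` is the disjoint union of `i₁ (X₁ \ Y)` and `i₂ X₂`. -/
def Glue.nf (f : Y → X₂) : Glue f → {x : X₁ // x ∉ Y} ⊕ X₂ :=
  Quot.lift
    (Sum.elim (fun x => if h : x ∈ Y then Sum.inr (f ⟨x, h⟩) else Sum.inl ⟨x, h⟩) Sum.inr)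
    (by rintro _ _ ⟨y⟩; simp)

/-- The inverse of `Glue.nf`. -/
def Glue.ofNf (f : Y → X₂) : {x : X₁ // x ∉ Y} ⊕ X₂ → Glue f :=
  Sum.elim (fun x => Glue.inl f x) (Glue.inr f)

theorem Glue.nf_inl (f : Y → X₂) {x : X₁} (h : x ∉ Y) :
    Glue.nf f (Glue.inl f x) = Sum.inl ⟨x, h⟩ := by
  simp [Glue.nf, Glue.inl, h]

theorem Glue.nf_inr (f : Y → X₂) (x : X₂) : Glue.nf f (Glue.inr f x) = Sum.inr x := rfl

theorem Glue.nf_ofNf (f : Y → X₂) (s : {x : X₁ // x ∉ Y} ⊕ X₂) :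
    Glue.nf f (Glue.ofNf f s) = s := by
  rcases s with ⟨x, h⟩ | x
  · exact Glue.nf_inl f h
  · rfl

theorem Glue.ofNf_nf (f : Y → X₂) (z : Glue f) : Glue.ofNf f (Glue.nf f z) = z := by
  induction z using Quot.ind with
  | mk s =>
    rcases s with x | x
    · by_cases h : x ∈ Y
      · have := Glue.inl_eq_inr f ⟨x, h⟩
        simp only at this
        change Glue.ofNf f (Glue.nf f (Glue.inl f x)) = Glue.inl f x
        rw [this]
        rfl
      · change Glue.ofNf f (Glue.nf f (Glue.inl f x)) = Glue.inl f x
        rw [Glue.nf_inl f h]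
        rfl
    · rfl

variable [DiffeologicalSpace X₁] [DiffeologicalSpace X₂]

theorem Glue.dSmooth_inl (f : Y → X₂) : DSmooth (Glue.inl f) := fun _ p hp _ =>
  ⟨_, ⟨Sum.inl ∘ p, fun _ => ⟨_, Or.inl ⟨p, hp, rfl⟩, Filter.Eventually.of_forall fun _ => rfl⟩,
    rfl⟩, Filter.Eventually.of_forall fun _ => rfl⟩

theorem Glue.dSmooth_inr (f : Y → X₂) : DSmooth (Glue.inr f) := fun _ p hp _ =>
  ⟨_, ⟨Sum.inr ∘ p, fun _ => ⟨_, Or.inr ⟨p, hp, rfl⟩, Filter.Eventually.of_forall fun _ => rfl⟩,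
    rfl⟩, Filter.Eventually.of_forall fun _ => rfl⟩

/-- Locally, a plot of `X₁ ∪_f X₂` lifts to a plot of `X₁` or to a plot of `X₂`. -/
theorem Glue.exists_lift (f : Y → X₂) {n : ℕ} {p : Eucl n → Glue f} (hp : IsPlot p)
    (x : Eucl n) :
    (∃ q : Eucl n → X₁, IsPlot q ∧ ∀ᶠ y in nhds x, p y = Glue.inl f (q y)) ∨
      ∃ q : Eucl n → X₂, IsPlot q ∧ ∀ᶠ y in nhds x, p y = Glue.inr f (q y) := by
  obtain ⟨_, ⟨q, hq, rfl⟩, hpq⟩ := hp x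
  obtain ⟨_, ⟨r, hr, rfl⟩ | ⟨r, hr, rfl⟩, hqr⟩ := hq x
  · exact Or.inl ⟨r, hr, by filter_upwards [hpq, hqr] with y h1 h2; exact h1.trans (congrArg (Quot.mk _) h2)⟩
  · exact Or.inr ⟨r, hr, by filter_upwards [hpq, hqr] with y h1 h2; exact h1.trans (congrArg (Quot.mk _) h2)⟩

end Glue

/-- A map that is locally equal to plots is a plot. -/
theorem isPlot_of_eventuallyEq {X : Type*} [DiffeologicalSpace X] {n : ℕ} {p : Eucl n → X}
    (h : ∀ x, ∃ q : Eucl n → X, IsPlot q ∧ ∀ᶠ y in nhds x, p y = q y) : IsPlot p :=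
  DiffeologicalSpace.locality fun x => by
    obtain ⟨q, hq, hpq⟩ := h x
    obtain ⟨u, hu, hu', hx⟩ := eventually_nhds_iff.mp hpq
    refine ⟨u, hu', hx, fun {m f} h1 h2 => ?_⟩
    have : p ∘ f = q ∘ f := funext fun y => hu _ (h1 y)
    rw [this]
    exact isPlot_reparam hq h2

/-! ## Diffeological vector spaces: duals and pseudo-metrics -/

section VectorSpace

variable {E E' : Type*} [AddCommGroup E] [Module ℝ E] [DiffeologicalSpace E]
  [AddCommGroup E'] [Module ℝ E'] [DiffeologicalSpace E']

/-- The diffeological dual `L^∞(E, ℝ)` of a diffeological vector space: the space of all smooth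
linear maps to `ℝ`. -/
def SmoothDual (E : Type*) [AddCommGroup E] [Module ℝ E] [DiffeologicalSpace E] :
    Submodule ℝ (E →ₗ[ℝ] ℝ) where
  carrier := {φ | DSmooth φ}
  add_mem' hφ hψ := fun n p hp =>
    ((hφ n p hp).contDiff.add (hψ n p hp).contDiff).isPlot
  zero_mem' := fun _ _ _ => isPlot_const
  smul_mem' c _ hφ := fun n p hp => ((hφ n p hp).contDiff.const_smul c).isPlot

/-- The dual map `φ ↦ φ ∘ L` of a smooth linear map `L`. -/
def SmoothDual.pullback (L : E →ₗ[ℝ] E') (hL : DSmooth L) :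
    SmoothDual E' →ₗ[ℝ] SmoothDual E where
  toFun φ := ⟨φ.1 ∘ₗ L, φ.2.comp hL⟩
  map_add' _ _ := rfl
  map_smul' _ _ := rfl

/-- A pseudo-metric on a finite-dimensional diffeological vector space: a smooth symmetric
positive semi-definite bilinear form whose rank is the dimension of the diffeological dual. -/
structure IsPseudoMetric (b : LinearMap.BilinForm ℝ E) : Prop where
  smooth : DSmooth (fun p : E × E => b p.1 p.2)
  symm : ∀ v w, b v w = b w v
  nonneg : ∀ v, 0 ≤ b v v
  rank : Module.finrank ℝ (LinearMap.range b) = Module.finrank ℝ (SmoothDual E)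

/-- The form induced by a pseudo-metric `b` on the diffeological dual:
its value at `(b v, b w)` is `b v w`. -/
def dualForm (b : LinearMap.BilinForm ℝ E) (φ ψ : SmoothDual E) : ℝ :=
  b (Function.invFun (fun v => b v) (φ : E →ₗ[ℝ] ℝ))
    (Function.invFun (fun v => b v) (ψ : E →ₗ[ℝ] ℝ))

theorem dualForm_eq {b : LinearMap.BilinForm ℝ E} (hb : ∀ v w, b v w = b w v)
    {φ ψ : SmoothDual E} {v w : E} (hv : b v = φ) (hw : b w = ψ) : dualForm b φ ψ = b v w := by
  have h1 : b (Function.invFun (fun v => b v) (φ : E →ₗ[ℝ] ℝ)) = φ :=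
    Function.invFun_eq (f := fun v => b v) ⟨v, hv⟩
  have h2 : b (Function.invFun (fun v => b v) (ψ : E →ₗ[ℝ] ℝ)) = ψ :=
    Function.invFun_eq (f := fun v => b v) ⟨w, hw⟩
  rw [dualForm, h1, ← hv, hb, h2, ← hw, hb]

/-- For a pseudo-metric on a finite-dimensional space, every smooth functional is of the form
`b v`, so that `dualForm_eq` determines `dualForm b`. -/
theorem IsPseudoMetric.exists_eq [FiniteDimensional ℝ E] {b : LinearMap.BilinForm ℝ E}
    (hb : IsPseudoMetric b) (φ : SmoothDual E) : ∃ v, b v = φ := by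
  have hle : LinearMap.range b ≤ SmoothDual E := by
    rintro _ ⟨v, rfl⟩
    intro n p hp
    exact hb.smooth n (fun u => (v, p u)) ⟨isPlot_const, hp⟩
  have := Submodule.eq_of_le_of_finrank_eq hle hb.rank
  have h : (φ : E →ₗ[ℝ] ℝ) ∈ LinearMap.range b := by rw [this]; exact φ.2
  exact h

/-- The bilinear form on `E` given by an element of `E* ⊗ E*`:
`(φ ⊗ ψ)(v, w) = φ v * ψ w`. -/
def tensorForm : (SmoothDual E ⊗[ℝ] SmoothDual E) →ₗ[ℝ] LinearMap.BilinForm ℝ E :=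
  TensorProduct.lift (LinearMap.mk₂ ℝ
    (fun φ ψ => LinearMap.BilinForm.linMulLin (φ : E →ₗ[ℝ] ℝ) (ψ : E →ₗ[ℝ] ℝ))
    (by intros; ext; simp [add_mul]) (by intros; ext; simp [mul_assoc])
    (by intros; ext; simp [mul_add]) (by intros; ext; simp [mul_left_comm]))

theorem tensorForm_tmul (φ ψ : SmoothDual E) (v w : E) :
    tensorForm (φ ⊗ₜ[ℝ] ψ) v w = φ.1 v * ψ.1 w := by
  simp [tensorForm]

end VectorSpace

/-! ## Diffeological vector pseudo-bundles -/

/-- The fibre `π⁻¹(x)`; it carries the subset diffeology. -/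
abbrev FibreOf {V X : Type*} (π : V → X) (x : X) : Type _ := {v : V // π v = x}

/-- A diffeological vector pseudo-bundle `π : V → X`. (Surjectivity of `π` is automatic because
each fibre is a vector space, hence non-empty.) -/
structure PseudoBundle (V X : Type*) [DiffeologicalSpace V] [DiffeologicalSpace X] where
  proj : V → X
  addCommGroup : ∀ x, AddCommGroup (FibreOf proj x)
  module : ∀ x, Module ℝ (FibreOf proj x)
  smooth_proj : DSmooth proj
  smooth_add : DSmooth (fun p : {p : V × V // proj p.1 = proj p.2} =>
    (((⟨p.1.1, p.2⟩ : FibreOf proj (proj p.1.2)) + ⟨p.1.2, rfl⟩ : FibreOf proj (proj p.1.2)) : V))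
  smooth_smul : DSmooth (fun p : ℝ × V =>
    ((p.1 • (⟨p.2, rfl⟩ : FibreOf proj (proj p.2)) : FibreOf proj (proj p.2)) : V))
  smooth_zero : DSmooth (fun x => ((0 : FibreOf proj x) : V))

namespace PseudoBundle

variable {V X : Type*} [DiffeologicalSpace V] [DiffeologicalSpace X]

/-- The fibre of a pseudo-bundle. -/
abbrev Fibre (P : PseudoBundle V X) (x : X) : Type _ := FibreOf P.proj x

instance (P : PseudoBundle V X) (x : X) : AddCommGroup (P.Fibre x) := P.addCommGroup x

instance (P : PseudoBundle V X) (x : X) : Module ℝ (P.Fibre x) := P.module x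

theorem surjective_proj (P : PseudoBundle V X) : Function.Surjective P.proj :=
  fun x => ⟨(0 : P.Fibre x).1, (0 : P.Fibre x).2⟩

/-- The fibres are finite-dimensional. -/
def FiniteDim (P : PseudoBundle V X) : Prop := ∀ x, FiniteDimensional ℝ (P.Fibre x)

/-- Local triviality: every `x` has a D-open neighbourhood `U` over which `π` is isomorphic, by a
fibrewise linear diffeomorphism over `U`, to a product `U × F` with a diffeological vector
space `F`. (Such an `F` is isomorphic to the fibre over `x`, so `F` is taken to be that fibre.) -/
def LocallyTrivial (P : PseudoBundle V X) : Prop :=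
  ∀ x : X, ∃ U : Set X, IsOpen[dTopology] U ∧ x ∈ U ∧
    ∃ e : {v : V // P.proj v ∈ U} ≃ U × P.Fibre x,
      DSmooth e ∧ DSmooth e.symm ∧ (∀ v, ((e v).1 : X) = P.proj v) ∧
      ∀ u : U, IsLinearMap ℝ (fun v : P.Fibre u => (e ⟨v.1, v.2.symm ▸ u.2⟩).2)

/-! ### The dual pseudo-bundle -/

/-- The total space `V* = ⋃ₓ (π⁻¹(x))*` of the dual pseudo-bundle. -/
structure Dual (P : PseudoBundle V X) where
  base : X
  functional : SmoothDual (P.Fibre base)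

/-- The value of an element of `V*` on a vector of the corresponding fibre. -/
def Dual.eval {P : PseudoBundle V X} (φ : P.Dual) (v : V) (h : P.proj v = φ.base) : ℝ :=
  φ.functional.1 ⟨v, h⟩

theorem Dual.eval_congr {P : PseudoBundle V X} {φ ψ : P.Dual} {v w : V} (h1 : φ = ψ)
    (h2 : v = w) (h : P.proj v = φ.base) (h' : P.proj w = ψ.base) :
    φ.eval v h = ψ.eval w h' := by
  subst h1 h2
  rfl

/-- The condition for `q` to be a plot of `V*`: its projection to `X` is a plot and, for every plot
`p` of `V`, the evaluation `(u', u) ↦ q(u')(p(u))` is smooth on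
`{(u', u) | π*(q(u')) = π(p(u))}` with the subset diffeology. -/
def IsDualPlot (P : PseudoBundle V X) {l : ℕ} (q : Eucl l → P.Dual) : Prop :=
  IsPlot (fun u => (q u).base) ∧
    ∀ (m : ℕ) (p : Eucl m → V), IsPlot p →
      DSmooth (fun z : {z : Eucl l × Eucl m // P.proj (p z.2) = (q z.1).base} =>
        (q z.1.1).eval (p z.1.2) z.2)

theorem IsDualPlot.contDiff {P : PseudoBundle V X} {l k : ℕ} {q : Eucl l → P.Dual}
    (hq : P.IsDualPlot q) {a : Eucl k → Eucl l} (ha : ContDiff ℝ ∞ a) {p : Eucl k → V}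
    (hp : IsPlot p) (h : ∀ t, P.proj (p t) = (q (a t)).base) :
    ContDiff ℝ ∞ (fun t => (q (a t)).eval (p t) (h t)) :=
  (hq.2 k p hp k (fun t => ⟨(a t, t), h t⟩) ⟨ha.isPlot, contDiff_id.isPlot⟩).contDiff

theorem isDualPlot_of_contDiff {P : PseudoBundle V X} {l : ℕ} {q : Eucl l → P.Dual}
    (hbase : IsPlot (fun u => (q u).base))
    (hq : ∀ (k : ℕ) (a : Eucl k → Eucl l) (p : Eucl k → V), ContDiff ℝ ∞ a → IsPlot p →
      ∀ h : ∀ t, P.proj (p t) = (q (a t)).base,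
        ContDiff ℝ ∞ (fun t => (q (a t)).eval (p t) (h t))) : P.IsDualPlot q :=
  ⟨hbase, fun _ _ hp k z hz => (hq k (fun t => (z t).1.1) _ hz.1.contDiff
    (isPlot_reparam hp hz.2.contDiff) (fun t => (z t).2)).isPlot⟩

theorem IsDualPlot.locality {P : PseudoBundle V X} {l : ℕ} {q : Eucl l → P.Dual}
    (hq : ∀ x, ∃ u : Set (Eucl l), IsOpen u ∧ x ∈ u ∧ ∀ {m : ℕ} {f : Eucl m → Eucl l},
      (∀ x, f x ∈ u) → ContDiff ℝ ∞ f → P.IsDualPlot (q ∘ f)) : P.IsDualPlot q := by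
  refine isDualPlot_of_contDiff (DiffeologicalSpace.locality fun x => ?_) ?_
  · obtain ⟨u, hu, hx, h⟩ := hq x
    exact ⟨u, hu, hx, fun {m f} h1 h2 => (h h1 h2).1⟩
  · intro k a p ha hp h
    refine contDiff_iff_contDiffAt.mpr fun t => ?_
    obtain ⟨u, hu, hx, hloc⟩ := hq (a t)
    obtain ⟨c, hc, hcu, hct⟩ :=
      exists_smooth_cutoff (hu.preimage ha.continuous) (x := t) hx
    have h1 := hloc (f := a ∘ c) hcu (ha.comp hc)
    have h2 := h1.contDiff (a := id) contDiff_id (isPlot_reparam hp hc) (fun s => h (c s))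
    refine h2.contDiffAt.congr_of_eventuallyEq ?_
    filter_upwards [hct] with s hs
    exact Dual.eval_congr (by simp [hs]) (by simp [hs]) _ _

instance Dual.instDiffeologicalSpace (P : PseudoBundle V X) : DiffeologicalSpace P.Dual where
  plots l := {q | P.IsDualPlot q}
  constant_plots φ := isDualPlot_of_contDiff isPlot_const fun k a p _ hp h =>
    (φ.functional.2 k (fun t => ⟨p t, h t⟩) hp).contDiff
  plot_reparam {n m q f} hq hf := isDualPlot_of_contDiff (isPlot_reparam hq.1 hf)
    fun k a p ha hp h => IsDualPlot.contDiff hq (hf.comp ha) hp h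
  locality hq := IsDualPlot.locality hq

/-- The fibre of `V* → X` over `x` is the diffeological dual of `π⁻¹(x)`. -/
def dualFibreEquiv (P : PseudoBundle V X) (x : X) :
    FibreOf (Dual.base : P.Dual → X) x ≃ SmoothDual (P.Fibre x) where
  toFun φ := φ.2 ▸ φ.1.functional
  invFun φ := ⟨⟨x, φ⟩, rfl⟩
  left_inv := by rintro ⟨⟨_, φ⟩, rfl⟩; rfl
  right_inv _ := rfl

instance dualAddCommGroup (P : PseudoBundle V X) (x : X) :
    AddCommGroup (FibreOf (Dual.base : P.Dual → X) x) := (P.dualFibreEquiv x).addCommGroup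

instance dualModule (P : PseudoBundle V X) (x : X) :
    Module ℝ (FibreOf (Dual.base : P.Dual → X) x) := (P.dualFibreEquiv x).module ℝ

theorem dual_add_eval (P : PseudoBundle V X) {x : X}
    (φ ψ : FibreOf (Dual.base : P.Dual → X) x) (v : V) (h : P.proj v = (φ + ψ).1.base) :
    (φ + ψ).1.eval v h = φ.1.eval v (h.trans ((φ + ψ).2.trans φ.2.symm)) +
      ψ.1.eval v (h.trans ((φ + ψ).2.trans ψ.2.symm)) := by
  obtain ⟨⟨x, φ⟩, rfl⟩ := φ
  obtain ⟨⟨y, ψ⟩, hy⟩ := ψ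
  obtain rfl : y = x := hy
  rfl

theorem dual_smul_eval (P : PseudoBundle V X) {x : X} (c : ℝ)
    (φ : FibreOf (Dual.base : P.Dual → X) x) (v : V) (h : P.proj v = (c • φ).1.base) :
    (c • φ).1.eval v h = c * φ.1.eval v (h.trans ((c • φ).2.trans φ.2.symm)) := by
  obtain ⟨⟨x, φ⟩, rfl⟩ := φ
  rfl

/-- The dual pseudo-bundle `π* : V* → X`. -/
def dual (P : PseudoBundle V X) : PseudoBundle P.Dual X where
  proj := Dual.base
  addCommGroup := P.dualAddCommGroup
  module := P.dualModule
  smooth_proj _ _ hq := hq.1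
  smooth_add := by
    intro n q hq
    have hb : ∀ u, (((⟨(q u).1.1, (q u).2⟩ : FibreOf (Dual.base : P.Dual → X) _) +
        ⟨(q u).1.2, rfl⟩ : FibreOf (Dual.base : P.Dual → X) (q u).1.2.base) : P.Dual).base =
        (q u).1.2.base := fun u =>
        (((⟨(q u).1.1, (q u).2⟩ : FibreOf (Dual.base : P.Dual → X) _) +
        ⟨(q u).1.2, rfl⟩ : FibreOf (Dual.base : P.Dual → X) (q u).1.2.base)).2
    refine isDualPlot_of_contDiff ?_ fun k a p ha hp h => ?_
    · simp only [Function.comp_apply, hb]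
      exact hq.2.1
    · simp only [Function.comp_apply, dual_add_eval]
      exact (IsDualPlot.contDiff hq.1 ha hp _).add (IsDualPlot.contDiff hq.2 ha hp _)
  smooth_smul := by
    intro n q hq
    have hb : ∀ u, (((q u).1 • (⟨(q u).2, rfl⟩ : FibreOf (Dual.base : P.Dual → X) _) :
        FibreOf (Dual.base : P.Dual → X) (q u).2.base) : P.Dual).base =
        (q u).2.base := fun u =>
        ((q u).1 • (⟨(q u).2, rfl⟩ : FibreOf (Dual.base : P.Dual → X) (q u).2.base)).2
    refine isDualPlot_of_contDiff ?_ fun k a p ha hp h => ?_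
    · simp only [Function.comp_apply, hb]
      exact hq.2.1
    · simp only [Function.comp_apply, dual_smul_eval]
      exact (hq.1.contDiff.comp ha).mul (IsDualPlot.contDiff hq.2 ha hp _)
  smooth_zero := fun n p hp => isDualPlot_of_contDiff hp fun k a q _ _ _ => contDiff_const

/-! ### Pseudo-metrics -/

/-- The total space of `V* ⊗ V*`. -/
structure DualTensor (P : PseudoBundle V X) where
  base : X
  tensor : SmoothDual (P.Fibre base) ⊗[ℝ] SmoothDual (P.Fibre base)

/-- The conditions for a diffeology `d` on `V* ⊗ V*` to make it a diffeological vector pseudo-bundle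
over `X` such that `V* ×_X V* → V* ⊗ V*` is smooth. -/
structure DualTensor.IsAdmissible (P : PseudoBundle V X) (d : DiffeologicalSpace P.DualTensor) :
    Prop where
  smooth_base : DSmooth (DualTensor.base : P.DualTensor → X)
  smooth_add : ∀ (n : ℕ) (b : Eucl n → X)
    (s t : ∀ u, SmoothDual (P.Fibre (b u)) ⊗[ℝ] SmoothDual (P.Fibre (b u))),
    IsPlot (fun u => (⟨b u, s u⟩ : P.DualTensor)) →
    IsPlot (fun u => (⟨b u, t u⟩ : P.DualTensor)) →
    IsPlot (fun u => (⟨b u, s u + t u⟩ : P.DualTensor))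
  smooth_smul : DSmooth (fun p : ℝ × P.DualTensor => (⟨p.2.base, p.1 • p.2.tensor⟩ : P.DualTensor))
  smooth_zero : DSmooth (fun x => (⟨x, 0⟩ : P.DualTensor))
  smooth_tmul : ∀ (n : ℕ) (b : Eucl n → X) (φ ψ : ∀ u, SmoothDual (P.Fibre (b u))),
    IsPlot (fun u => (⟨b u, φ u⟩ : P.Dual)) → IsPlot (fun u => (⟨b u, ψ u⟩ : P.Dual)) →
    IsPlot (fun u => (⟨b u, φ u ⊗ₜ[ℝ] ψ u⟩ : P.DualTensor))

/-- The tensor product diffeology on `V* ⊗ V*`: the finest admissible diffeology. -/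
instance DualTensor.instDiffeologicalSpace (P : PseudoBundle V X) :
    DiffeologicalSpace P.DualTensor :=
  sInf {d | DualTensor.IsAdmissible P d}

/-- A pseudo-metric on a pseudo-bundle with finite-dimensional fibres: a smooth section of
`V* ⊗ V*` whose value at each `x` is a pseudo-metric on the fibre over `x`. -/
structure PseudoMetric (P : PseudoBundle V X) where
  toFun : ∀ x, SmoothDual (P.Fibre x) ⊗[ℝ] SmoothDual (P.Fibre x)
  smooth : DSmooth (fun x => (⟨x, toFun x⟩ : P.DualTensor))
  isPseudoMetric : ∀ x, IsPseudoMetric (tensorForm (toFun x))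

/-- The bilinear form `g(x)` on the fibre over `x`. -/
def PseudoMetric.form {P : PseudoBundle V X} (g : P.PseudoMetric) (x : X) :
    LinearMap.BilinForm ℝ (P.Fibre x) := tensorForm (g.toFun x)

/-- The induced dual pseudo-metric `g*(x)` on `(π⁻¹(x))*`, given by
`g*(x)(g(x)(v, ·), g(x)(w, ·)) = g(x)(v, w)`. -/
def PseudoMetric.dual {P : PseudoBundle V X} (g : P.PseudoMetric) (x : X)
    (φ ψ : SmoothDual (P.Fibre x)) : ℝ := dualForm (g.form x) φ ψ


/-! ## Gluing of pseudo-bundles -/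

section Gluing

variable {V₁ X₁ V₂ X₂ : Type*} [DiffeologicalSpace V₁] [DiffeologicalSpace X₁]
  [DiffeologicalSpace V₂] [DiffeologicalSpace X₂]

theorem mem_of_fibre {V X : Type*} {π : V → X} {Y : Set X} {x : X} (v : FibreOf π x) (hx : x ∈ Y) :
    v.1 ∈ π ⁻¹' Y := by
  simpa [v.2] using hx

/-- A gluing of `P₁ : V₁ → X₁` to `P₂ : V₂ → X₂` along a pair `(f̃, f)`: a smooth map
`f : X₁ ⊇ Y → X₂` and a smooth lift `f̃ : π₁⁻¹(Y) → V₂` of `f` that is linear on each fibre. -/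
structure Gluing (P₁ : PseudoBundle V₁ X₁) (P₂ : PseudoBundle V₂ X₂) where
  Y : Set X₁
  f : Y → X₂
  smooth_f : DSmooth f
  lift : (P₁.proj ⁻¹' Y : Set V₁) → V₂
  smooth_lift : DSmooth lift
  proj_lift : ∀ v, P₂.proj (lift v) = f ⟨P₁.proj v, v.2⟩
  lift_linear : ∀ y : Y, IsLinearMap ℝ (fun v : P₁.Fibre y =>
    (⟨lift ⟨v.1, mem_of_fibre v y.2⟩, (proj_lift _).trans (congrArg f (Subtype.ext v.2))⟩ :
      P₂.Fibre (f y)))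

namespace Gluing

variable {P₁ : PseudoBundle V₁ X₁} {P₂ : PseudoBundle V₂ X₂} (G : Gluing P₁ P₂)

/-- The restriction of `f̃` to the fibre over `y ∈ Y`, as a linear map to the fibre over
`x = f y`. -/
def fibreMap (y : G.Y) (x : X₂) (h : G.f y = x) : P₁.Fibre y →ₗ[ℝ] P₂.Fibre x where
  toFun v := ⟨G.lift ⟨v.1, mem_of_fibre v y.2⟩,
    ((G.proj_lift _).trans (congrArg G.f (Subtype.ext v.2))).trans h⟩
  map_add' v w := by
    subst h
    exact (G.lift_linear y).map_add v w
  map_smul' c v := by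
    subst h
    exact (G.lift_linear y).map_smul c v

theorem dSmooth_fibreMap (y : G.Y) (x : X₂) (h : G.f y = x) : DSmooth (G.fibreMap y x h) :=
  fun n p hp => G.smooth_lift n (fun u => ⟨(p u).1, mem_of_fibre (p u) y.2⟩) hp

/-- The projection `π₁ ∪_{(f̃,f)} π₂ : V₁ ∪_f̃ V₂ → X₁ ∪_f X₂`. -/
def glueProj : Glue G.lift → Glue G.f :=
  Quot.map (Sum.map P₁.proj P₂.proj) (by
    rintro _ _ ⟨v⟩
    have := GlueRel.glue (f := G.f) ⟨P₁.proj v, v.2⟩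
    rw [← G.proj_lift] at this
    exact this)

/-- The map `j₁` on the fibre over `x`, which is an isomorphism if `x ∉ Y`. -/
def fibreInl (x : X₁) (v : P₁.Fibre x) : FibreOf G.glueProj (Glue.inl G.f x) :=
  ⟨Glue.inl G.lift v.1, congrArg (Glue.inl G.f) v.2⟩

/-- The isomorphism `j₂` on the fibre over `x`. -/
def fibreInr (x : X₂) (v : P₂.Fibre x) : FibreOf G.glueProj (Glue.inr G.f x) :=
  ⟨Glue.inr G.lift v.1, congrArg (Glue.inr G.f) v.2⟩

theorem bijective_fibreInl {x : X₁} (hx : x ∉ G.Y) : Function.Bijective (G.fibreInl x) := by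
  constructor
  · rintro ⟨v, rfl⟩ ⟨w, hw⟩ h
    have h1 : Glue.inl G.lift v = Glue.inl G.lift w := congrArg Subtype.val h
    have h2 := congrArg (Glue.nf G.lift) h1
    rw [Glue.nf_inl _ (show v ∉ P₁.proj ⁻¹' G.Y from hx),
      Glue.nf_inl _ (show w ∉ P₁.proj ⁻¹' G.Y by simpa [hw] using hx)] at h2
    simpa using h2
  · rintro ⟨w, hw⟩
    induction w using Quot.ind with
    | mk s =>
      have hw' := congrArg (Glue.nf G.f) hw
      rw [Glue.nf_inl _ hx] at hw'
      rcases s with v | v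
      · have h1 : Glue.nf G.f (Glue.inl G.f (P₁.proj v)) = Sum.inl ⟨x, hx⟩ := hw'
        by_cases hv : P₁.proj v ∈ G.Y
        · rw [show Glue.inl G.f (P₁.proj v) = _ from Glue.inl_eq_inr G.f ⟨_, hv⟩,
            Glue.nf_inr] at h1
          cases h1
        · rw [Glue.nf_inl _ hv] at h1
          exact ⟨⟨v, by simpa using h1⟩, rfl⟩
      · have h1 : Glue.nf G.f (Glue.inr G.f (P₂.proj v)) = Sum.inl ⟨x, hx⟩ := hw'
        rw [Glue.nf_inr] at h1
        cases h1

theorem bijective_fibreInr (x : X₂) : Function.Bijective (G.fibreInr x) := by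
  constructor
  · rintro ⟨v, rfl⟩ ⟨w, hw⟩ h
    have h1 : Glue.inr G.lift v = Glue.inr G.lift w := congrArg Subtype.val h
    have h2 := congrArg (Glue.nf G.lift) h1
    rw [Glue.nf_inr, Glue.nf_inr] at h2
    simpa using h2
  · rintro ⟨w, hw⟩
    have key : ∀ v : V₂, Glue.inr G.f (P₂.proj v) = Glue.inr G.f x →
        ∃ a, (G.fibreInr x a).1 = Glue.inr G.lift v := by
      intro v h
      have h1 := congrArg (Glue.nf G.f) h
      rw [Glue.nf_inr, Glue.nf_inr] at h1
      exact ⟨⟨v, by simpa using h1⟩, rfl⟩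
    induction w using Quot.ind with
    | mk s =>
      rcases s with v | v
      · by_cases hv : P₁.proj v ∈ G.Y
        · have h2 : Glue.inl G.lift v = _ := Glue.inl_eq_inr G.lift ⟨v, hv⟩
          have hw2 : Glue.inr G.f (P₂.proj (G.lift ⟨v, hv⟩)) = Glue.inr G.f x :=
            (congrArg G.glueProj h2).symm.trans hw
          obtain ⟨a, ha⟩ := key _ hw2
          exact ⟨a, Subtype.ext (ha.trans h2.symm)⟩
        · have hw' := congrArg (Glue.nf G.f) hw
          have h1 : Glue.nf G.f (Glue.inl G.f (P₁.proj v)) = Sum.inr x := hw'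
          rw [Glue.nf_inl _ hv] at h1
          cases h1
      · obtain ⟨a, ha⟩ := key v hw
        exact ⟨a, Subtype.ext ha⟩

/-- The vector space structures on the fibres of `V₁ ∪_f̃ V₂`, inherited from `V₁` over
`i₁(X₁ \ Y)` and from `V₂` over `i₂(X₂)`. -/
def glueStruct' : ∀ s : {x : X₁ // x ∉ G.Y} ⊕ X₂,
    (_ : AddCommGroup (FibreOf G.glueProj (Glue.ofNf G.f s))) ×'
      Module ℝ (FibreOf G.glueProj (Glue.ofNf G.f s))
  | Sum.inl x =>
    let e := (Equiv.ofBijective _ (G.bijective_fibreInl x.2)).symm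
    ⟨e.addCommGroup, e.module ℝ⟩
  | Sum.inr x =>
    let e := (Equiv.ofBijective _ (G.bijective_fibreInr x)).symm
    ⟨e.addCommGroup, e.module ℝ⟩

/-- The vector space structure on the fibre of `V₁ ∪_f̃ V₂` over an arbitrary point. -/
def glueStruct (z : Glue G.f) :
    (_ : AddCommGroup (FibreOf G.glueProj z)) ×' Module ℝ (FibreOf G.glueProj z) :=
  cast (congrArg (fun z => (_ : AddCommGroup (FibreOf G.glueProj z)) ×'
    Module ℝ (FibreOf G.glueProj z)) (Glue.ofNf_nf G.f z)) (G.glueStruct' (Glue.nf G.f z))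

instance glueAddCommGroup (z : Glue G.f) : AddCommGroup (FibreOf G.glueProj z) :=
  (G.glueStruct z).1

instance glueModule (z : Glue G.f) : Module ℝ (FibreOf G.glueProj z) := (G.glueStruct z).2

theorem glueStruct_ofNf (s : {x : X₁ // x ∉ G.Y} ⊕ X₂) :
    G.glueStruct (Glue.ofNf G.f s) = G.glueStruct' s := by
  have h : ∀ s', s' = s → HEq (G.glueStruct' s') (G.glueStruct' s) := by
    rintro _ rfl
    rfl
  exact eq_of_heq ((cast_heq _ _).trans (h _ (Glue.nf_ofNf G.f s)))

theorem isLinearMap_fibreInr (x : X₂) : IsLinearMap ℝ (G.fibreInr x) := by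
  have hS : G.glueStruct (Glue.inr G.f x) = G.glueStruct' (Sum.inr x) :=
    G.glueStruct_ofNf (Sum.inr x)
  let e := (Equiv.ofBijective _ (G.bijective_fibreInr x)).symm
  have he : ∀ v, e (G.fibreInr x v) = v := fun v =>
    (Equiv.ofBijective _ (G.bijective_fibreInr x)).symm_apply_apply v
  constructor
  · intro v w
    change _ = (G.glueStruct (Glue.inr G.f x)).1.add (G.fibreInr x v) (G.fibreInr x w)
    rw [hS]
    change G.fibreInr x (v + w) = G.fibreInr x (e (G.fibreInr x v) + e (G.fibreInr x w))
    rw [he, he]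
  · intro c v
    change _ = (G.glueStruct (Glue.inr G.f x)).2.smul c (G.fibreInr x v)
    rw [hS]
    change G.fibreInr x (c • v) = G.fibreInr x (c • e (G.fibreInr x v))
    rw [he]

theorem isLinearMap_fibreInl (x : X₁) : IsLinearMap ℝ (G.fibreInl x) := by
  by_cases hx : x ∈ G.Y
  · have h0 : Glue.inr G.f (G.f ⟨x, hx⟩) = Glue.inl G.f x := (Glue.inl_eq_inr G.f ⟨x, hx⟩).symm
    have h1 : ∀ z, (h : Glue.inr G.f (G.f ⟨x, hx⟩) = z) → IsLinearMap ℝ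
        (fun v : P₁.Fibre x => (⟨(G.fibreInr _ (G.fibreMap ⟨x, hx⟩ _ rfl v)).1,
          (G.fibreInr _ (G.fibreMap ⟨x, hx⟩ _ rfl v)).2.trans h⟩ : FibreOf G.glueProj z)) := by
      rintro _ rfl
      constructor
      · intro v w
        rw [map_add, (G.isLinearMap_fibreInr _).map_add]
      · intro c v
        rw [map_smul, (G.isLinearMap_fibreInr _).map_smul]
    convert! h1 _ h0 using 1
    funext v
    exact Subtype.ext (Glue.inl_eq_inr G.lift ⟨v.1, by simpa [v.2] using hx⟩)
  · have hS : G.glueStruct (Glue.inl G.f x) = G.glueStruct' (Sum.inl ⟨x, hx⟩) :=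
      G.glueStruct_ofNf (Sum.inl ⟨x, hx⟩)
    let e := (Equiv.ofBijective _ (G.bijective_fibreInl hx)).symm
    have he : ∀ v, e (G.fibreInl x v) = v := fun v =>
      (Equiv.ofBijective _ (G.bijective_fibreInl hx)).symm_apply_apply v
    constructor
    · intro v w
      change _ = (G.glueStruct (Glue.inl G.f x)).1.add (G.fibreInl x v) (G.fibreInl x w)
      rw [hS]
      change G.fibreInl x (v + w) = G.fibreInl x (e (G.fibreInl x v) + e (G.fibreInl x w))
      rw [he, he]
    · intro c v
      change _ = (G.glueStruct (Glue.inl G.f x)).2.smul c (G.fibreInl x v)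
      rw [hS]
      change G.fibreInl x (c • v) = G.fibreInl x (c • e (G.fibreInl x v))
      rw [he]

theorem coe_add_inl {z : Glue G.f} {a b : FibreOf G.glueProj z} {v w : V₁}
    (ha : a.1 = Glue.inl G.lift v) (hb : b.1 = Glue.inl G.lift w)
    (hvw : P₁.proj v = P₁.proj w) :
    (a + b).1 = Glue.inl G.lift
      (((⟨v, hvw⟩ : P₁.Fibre (P₁.proj w)) + ⟨w, rfl⟩ : P₁.Fibre (P₁.proj w)) : V₁) := by
  obtain ⟨a, haz⟩ := a
  obtain ⟨b, hbz⟩ := b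
  simp only at ha hb
  subst ha hb hbz
  exact congrArg Subtype.val ((G.isLinearMap_fibreInl _).map_add ⟨v, hvw⟩ ⟨w, rfl⟩).symm

theorem coe_add_inr {z : Glue G.f} {a b : FibreOf G.glueProj z} {v w : V₂}
    (ha : a.1 = Glue.inr G.lift v) (hb : b.1 = Glue.inr G.lift w)
    (hvw : P₂.proj v = P₂.proj w) :
    (a + b).1 = Glue.inr G.lift
      (((⟨v, hvw⟩ : P₂.Fibre (P₂.proj w)) + ⟨w, rfl⟩ : P₂.Fibre (P₂.proj w)) : V₂) := by
  obtain ⟨a, haz⟩ := a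
  obtain ⟨b, hbz⟩ := b
  simp only at ha hb
  subst ha hb hbz
  exact congrArg Subtype.val ((G.isLinearMap_fibreInr _).map_add ⟨v, hvw⟩ ⟨w, rfl⟩).symm

theorem coe_smul_inl {z : Glue G.f} (c : ℝ) {a : FibreOf G.glueProj z} {v : V₁}
    (ha : a.1 = Glue.inl G.lift v) : (c • a).1 =
      Glue.inl G.lift ((c • (⟨v, rfl⟩ : P₁.Fibre (P₁.proj v)) : P₁.Fibre (P₁.proj v)) : V₁) := by
  obtain ⟨a, haz⟩ := a
  simp only at ha
  subst ha haz
  exact congrArg Subtype.val ((G.isLinearMap_fibreInl _).map_smul c ⟨v, rfl⟩).symm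

theorem coe_smul_inr {z : Glue G.f} (c : ℝ) {a : FibreOf G.glueProj z} {v : V₂}
    (ha : a.1 = Glue.inr G.lift v) : (c • a).1 =
      Glue.inr G.lift ((c • (⟨v, rfl⟩ : P₂.Fibre (P₂.proj v)) : P₂.Fibre (P₂.proj v)) : V₂) := by
  obtain ⟨a, haz⟩ := a
  simp only at ha
  subst ha haz
  exact congrArg Subtype.val ((G.isLinearMap_fibreInr _).map_smul c ⟨v, rfl⟩).symm

theorem coe_zero_inl {z : Glue G.f} {x : X₁} (h : z = Glue.inl G.f x) :
    (0 : FibreOf G.glueProj z).1 = Glue.inl G.lift (0 : P₁.Fibre x).1 := by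
  subst h
  exact congrArg Subtype.val (G.isLinearMap_fibreInl x).map_zero.symm

theorem coe_zero_inr {z : Glue G.f} {x : X₂} (h : z = Glue.inr G.f x) :
    (0 : FibreOf G.glueProj z).1 = Glue.inr G.lift (0 : P₂.Fibre x).1 := by
  subst h
  exact congrArg Subtype.val (G.isLinearMap_fibreInr x).map_zero.symm

theorem dSmooth_glueProj : DSmooth G.glueProj := by
  intro n p hp
  refine isPlot_of_eventuallyEq fun t => ?_
  rcases Glue.exists_lift _ hp t with ⟨q, hq, h⟩ | ⟨q, hq, h⟩
  · refine ⟨_, Glue.dSmooth_inl G.f _ _ (P₁.smooth_proj _ _ hq), ?_⟩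
    filter_upwards [h] with y hy
    exact congrArg G.glueProj hy
  · refine ⟨_, Glue.dSmooth_inr G.f _ _ (P₂.smooth_proj _ _ hq), ?_⟩
    filter_upwards [h] with y hy
    exact congrArg G.glueProj hy

/-- The point of `V₁` over `Y` corresponding to a vector glued to one of `V₂`. -/
theorem mem_of_glue_eq {x : X₁} {x' : X₂} (h : Glue.inl G.f x = Glue.inr G.f x') :
    ∃ hx : x ∈ G.Y, G.f ⟨x, hx⟩ = x' := by
  have h1 := congrArg (Glue.nf G.f) h
  rw [Glue.nf_inr] at h1
  by_cases hx : x ∈ G.Y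
  · refine ⟨hx, ?_⟩
    rw [show Glue.inl G.f x = _ from Glue.inl_eq_inr G.f ⟨x, hx⟩, Glue.nf_inr] at h1
    simpa using h1
  · rw [Glue.nf_inl _ hx] at h1
    cases h1

theorem eq_of_glue_eq (hf : Function.Injective G.f) {x x' : X₁}
    (h : Glue.inl G.f x = Glue.inl G.f x') : x = x' := by
  by_cases hx' : x' ∈ G.Y
  · have h2 : Glue.inl G.f x' = _ := Glue.inl_eq_inr G.f ⟨x', hx'⟩
    obtain ⟨hx, h3⟩ := G.mem_of_glue_eq (h.trans h2)
    simpa using hf h3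
  · have h1 := congrArg (Glue.nf G.f) h
    rw [Glue.nf_inl _ hx'] at h1
    by_cases hx : x ∈ G.Y
    · rw [show Glue.inl G.f x = _ from Glue.inl_eq_inr G.f ⟨x, hx⟩, Glue.nf_inr] at h1
      cases h1
    · rw [Glue.nf_inl _ hx] at h1
      simpa using h1

/-- Fibrewise addition of two families of vectors of `V₁ ∪_f̃ V₂` is smooth. -/
theorem dSmooth_glue_add (hf : Function.Injective G.f) :
    DSmooth (fun p : {p : Glue G.lift × Glue G.lift // G.glueProj p.1 = G.glueProj p.2} =>
      (((⟨p.1.1, p.2⟩ : FibreOf G.glueProj (G.glueProj p.1.2)) + ⟨p.1.2, rfl⟩ :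
        FibreOf G.glueProj (G.glueProj p.1.2)) : Glue G.lift)) := by
  intro n p hp
  refine DiffeologicalSpace.locality fun t => ?_
  have hrr : ∀ (m : ℕ) (c : Eucl m → Eucl n) (q q' : Eucl m → V₂), IsPlot q → IsPlot q' →
      (∀ s, (p (c s)).1.1 = Glue.inr G.lift (q s)) →
      (∀ s, (p (c s)).1.2 = Glue.inr G.lift (q' s)) →
      IsPlot (fun s => (((⟨(p (c s)).1.1, (p (c s)).2⟩ :
        FibreOf G.glueProj (G.glueProj (p (c s)).1.2)) + ⟨(p (c s)).1.2, rfl⟩ :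
        FibreOf G.glueProj (G.glueProj (p (c s)).1.2)) : Glue G.lift)) := by
    intro m c q q' hq hq' h h'
    have hproj : ∀ s, P₂.proj (q s) = P₂.proj (q' s) := by
      intro s
      have h1 := (p (c s)).2
      rw [h, h'] at h1
      have h2 := congrArg (Glue.nf G.f) h1
      exact Sum.inr_injective h2
    have h3 := Glue.dSmooth_inr G.lift _ _
      (P₂.smooth_add m (fun s => ⟨(q s, q' s), hproj s⟩) ⟨hq, hq'⟩)
    refine isPlot_of_eventuallyEq fun s => ⟨_, h3, Filter.Eventually.of_forall fun s => ?_⟩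
    exact G.coe_add_inr (h s) (h' s) (hproj s)
  have hcross : ∀ (m : ℕ) (q : Eucl m → V₁) (hq : IsPlot q) (hY : ∀ s, P₁.proj (q s) ∈ G.Y),
      IsPlot (fun s => G.lift ⟨q s, hY s⟩) := fun m q hq hY =>
    G.smooth_lift m (fun s => ⟨q s, hY s⟩) hq
  rcases Glue.exists_lift _ hp.1 t with ⟨q, hq, h⟩ | ⟨q, hq, h⟩ <;>
  rcases Glue.exists_lift _ hp.2 t with ⟨q', hq', h'⟩ | ⟨q', hq', h'⟩ <;>
  obtain ⟨u, hu, huo, htu⟩ := eventually_nhds_iff.mp (h.and h') <;>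
  refine ⟨u, huo, htu, fun {m c} hc hcs => ?_⟩
  · have hproj : ∀ s, P₁.proj (q (c s)) = P₁.proj (q' (c s)) := by
      intro s
      have h1 := (p (c s)).2
      rw [(hu _ (hc s)).1, (hu _ (hc s)).2] at h1
      exact G.eq_of_glue_eq hf h1
    have h3 := Glue.dSmooth_inl G.lift _ _
      (P₁.smooth_add m (fun s => ⟨(q (c s), q' (c s)), hproj s⟩)
        ⟨isPlot_reparam hq hcs, isPlot_reparam hq' hcs⟩)
    refine isPlot_of_eventuallyEq fun s => ⟨_, h3, Filter.Eventually.of_forall fun s => ?_⟩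
    exact G.coe_add_inl (hu _ (hc s)).1 (hu _ (hc s)).2 (hproj s)
  · have hY : ∀ s, P₁.proj (q (c s)) ∈ G.Y := by
      intro s
      have h1 := (p (c s)).2
      rw [(hu _ (hc s)).1, (hu _ (hc s)).2] at h1
      exact (G.mem_of_glue_eq h1).1
    exact hrr m c _ _ (hcross m _ (isPlot_reparam hq hcs) hY) (isPlot_reparam hq' hcs)
      (fun s => (hu _ (hc s)).1.trans (Glue.inl_eq_inr G.lift ⟨q (c s), hY s⟩))
      (fun s => (hu _ (hc s)).2)
  · have hY : ∀ s, P₁.proj (q' (c s)) ∈ G.Y := by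
      intro s
      have h1 := (p (c s)).2
      rw [(hu _ (hc s)).1, (hu _ (hc s)).2] at h1
      exact (G.mem_of_glue_eq h1.symm).1
    exact hrr m c _ _ (isPlot_reparam hq hcs) (hcross m _ (isPlot_reparam hq' hcs) hY)
      (fun s => (hu _ (hc s)).1)
      (fun s => (hu _ (hc s)).2.trans (Glue.inl_eq_inr G.lift ⟨q' (c s), hY s⟩))
  · exact hrr m c _ _ (isPlot_reparam hq hcs) (isPlot_reparam hq' hcs)
      (fun s => (hu _ (hc s)).1) (fun s => (hu _ (hc s)).2)

/-- The pseudo-bundle `π₁ ∪_{(f̃,f)} π₂ : V₁ ∪_f̃ V₂ → X₁ ∪_f X₂` obtained by gluing along a pair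
`(f̃, f)` with injective `f`. -/
def glue (hf : Function.Injective G.f) : PseudoBundle (Glue G.lift) (Glue G.f) where
  proj := G.glueProj
  addCommGroup := G.glueAddCommGroup
  module := G.glueModule
  smooth_proj := G.dSmooth_glueProj
  smooth_add := G.dSmooth_glue_add hf
  smooth_smul := by
    intro n p hp
    refine isPlot_of_eventuallyEq fun t => ?_
    rcases Glue.exists_lift _ hp.2 t with ⟨q, hq, h⟩ | ⟨q, hq, h⟩
    · refine ⟨_, Glue.dSmooth_inl G.lift _ _
        (P₁.smooth_smul n (fun s => ((p s).1, q s)) ⟨hp.1, hq⟩), ?_⟩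
      filter_upwards [h] with s hs
      exact G.coe_smul_inl _ hs
    · refine ⟨_, Glue.dSmooth_inr G.lift _ _
        (P₂.smooth_smul n (fun s => ((p s).1, q s)) ⟨hp.1, hq⟩), ?_⟩
      filter_upwards [h] with s hs
      exact G.coe_smul_inr _ hs
  smooth_zero := by
    intro n p hp
    refine isPlot_of_eventuallyEq fun t => ?_
    rcases Glue.exists_lift _ hp t with ⟨q, hq, h⟩ | ⟨q, hq, h⟩
    · refine ⟨_, Glue.dSmooth_inl G.lift _ _ (P₁.smooth_zero n q hq), ?_⟩
      filter_upwards [h] with s hs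
      exact G.coe_zero_inl hs
    · refine ⟨_, Glue.dSmooth_inr G.lift _ _ (P₂.smooth_zero n q hq), ?_⟩
      filter_upwards [h] with s hs
      exact G.coe_zero_inr hs

/-- `j₁` on the fibre over `x` as a linear map. -/
def inlFibre (hf : Function.Injective G.f) (x : X₁) :
    P₁.Fibre x →ₗ[ℝ] (G.glue hf).Fibre (Glue.inl G.f x) :=
  (G.isLinearMap_fibreInl x).mk'

theorem dSmooth_inlFibre (hf : Function.Injective G.f) (x : X₁) : DSmooth (G.inlFibre hf x) :=
  fun n p hp => Glue.dSmooth_inl G.lift n (fun u => (p u).1) hp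

/-- `j₂` on the fibre over `x` as a linear map. -/
def inrFibre (hf : Function.Injective G.f) (x : X₂) :
    P₂.Fibre x →ₗ[ℝ] (G.glue hf).Fibre (Glue.inr G.f x) :=
  (G.isLinearMap_fibreInr x).mk'

theorem dSmooth_inrFibre (hf : Function.Injective G.f) (x : X₂) : DSmooth (G.inrFibre hf x) :=
  fun n p hp => Glue.dSmooth_inr G.lift n (fun u => (p u).1) hp

/-! ### The induced gluing of the dual pseudo-bundles -/

/-- The inverse `f⁻¹ : f(Y) → Y` of an injective `f`. -/
def inv (hf : Function.Injective G.f) (x : Set.range G.f) : G.Y :=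
  (Equiv.ofInjective G.f hf).symm x

theorem f_inv (hf : Function.Injective G.f) (x : Set.range G.f) : G.f (G.inv hf x) = x :=
  Equiv.apply_ofInjective_symm hf x

theorem inv_f (hf : Function.Injective G.f) (y : G.Y) : G.inv hf ⟨G.f y, y, rfl⟩ = y :=
  Equiv.ofInjective_symm_apply hf y

/-- `f` is invertible: it is a diffeomorphism of its domain `Y` with its image `f(Y)`. -/
structure Invertible : Prop where
  injective : Function.Injective G.f
  smooth_inv : DSmooth (G.inv injective)

variable {G}

/-- The dual map `f̃*` on the dual fibre over `x ∈ f(Y)`, with values in the dual fibre over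
`f⁻¹(x)`. -/
def Invertible.dualMap (hG : G.Invertible) (x : Set.range G.f) :
    SmoothDual (P₂.Fibre x) →ₗ[ℝ] SmoothDual (P₁.Fibre (G.inv hG.injective x)) :=
  SmoothDual.pullback (G.fibreMap (G.inv hG.injective x) x (G.f_inv hG.injective x))
    (G.dSmooth_fibreMap _ _ _)

/-- The dual map `f̃* : V₂* ⊇ (π₂*)⁻¹(f(Y)) → V₁*`. -/
def Invertible.dualLift (hG : G.Invertible)
    (φ : (P₂.dual.proj ⁻¹' Set.range G.f : Set P₂.Dual)) : P₁.Dual :=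
  ⟨G.inv hG.injective ⟨φ.1.base, φ.2⟩, hG.dualMap ⟨φ.1.base, φ.2⟩ φ.1.functional⟩

theorem Invertible.dSmooth_dualLift (hG : G.Invertible) : DSmooth hG.dualLift := by
  intro n q hq
  refine isDualPlot_of_contDiff ?_ fun k a p ha hp h => ?_
  · exact hG.smooth_inv n (fun u => ⟨(q u).1.base, (q u).2⟩) hq.1
  · have hY : ∀ t, P₁.proj (p t) ∈ G.Y := fun t => by
      rw [h t]
      exact (G.inv hG.injective _).2
    have h2 : IsPlot (fun t => G.lift ⟨p t, hY t⟩) :=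
      G.smooth_lift k (fun t => ⟨p t, hY t⟩) hp
    have h3 : ∀ t, P₂.proj (G.lift ⟨p t, hY t⟩) = (q (a t)).1.base := fun t => by
      rw [G.proj_lift]
      exact (congrArg G.f (Subtype.ext (h t))).trans
        (G.f_inv hG.injective ⟨(q (a t)).1.base, (q (a t)).2⟩)
    exact IsDualPlot.contDiff hq ha h2 h3

/-- The gluing of `π₂* : V₂* → X₂` to `π₁* : V₁* → X₁` along `(f̃*, f⁻¹)`. -/
def Invertible.dualGluing (hG : G.Invertible) : Gluing P₂.dual P₁.dual where
  Y := Set.range G.f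
  f x := G.inv hG.injective x
  smooth_f := hG.smooth_inv
  lift := hG.dualLift
  smooth_lift := hG.dSmooth_dualLift
  proj_lift _ := rfl
  lift_linear := by
    rintro ⟨x, hx⟩
    constructor
    · rintro ⟨⟨b, φ⟩, hb⟩ ⟨⟨b', ψ⟩, hb'⟩
      obtain rfl : b = x := hb
      obtain rfl : b' = b := hb'
      rfl
    · rintro c ⟨⟨b, φ⟩, hb⟩
      obtain rfl : b = x := hb
      rfl

theorem Invertible.dualGluing_injective (hG : G.Invertible) :
    Function.Injective hG.dualGluing.f := fun x x' h => by
  have h1 : G.inv hG.injective x = G.inv hG.injective x' := Subtype.ext h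
  exact (Equiv.ofInjective G.f hG.injective).symm.injective h1

/-- The pseudo-bundle `(V₁ ∪_f̃ V₂)* → X₁ ∪_f X₂`. -/
abbrev Invertible.glueDual (hG : G.Invertible) : PseudoBundle (G.glue hG.injective).Dual (Glue G.f) :=
  (G.glue hG.injective).dual

/-- The pseudo-bundle `V₂* ∪_f̃* V₁* → X₂ ∪_{f⁻¹} X₁`. -/
abbrev Invertible.dualGlue (hG : G.Invertible) :
    PseudoBundle (Glue hG.dualGluing.lift) (Glue hG.dualGluing.f) :=
  hG.dualGluing.glue hG.dualGluing_injective

/-- The switch map `X₁ ∪_f X₂ → X₂ ∪_{f⁻¹} X₁`, which interchanges the two terms. -/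
def Invertible.switch (hG : G.Invertible) : Glue G.f → Glue hG.dualGluing.f :=
  Quot.lift (Sum.elim (Glue.inr hG.dualGluing.f) (Glue.inl hG.dualGluing.f)) (by
    rintro _ _ ⟨y⟩
    have h1 := Glue.inl_eq_inr hG.dualGluing.f ⟨G.f y, y, rfl⟩
    have h2 : hG.dualGluing.f ⟨G.f y, y, rfl⟩ = y.1 := congrArg Subtype.val (G.inv_f _ y)
    rw [h2] at h1
    exact h1.symm)

/-- The gluing-dual commutativity condition for `V₁`, `V₂` and `(f̃, f)`: there is a diffeomorphism
`Φ : (V₁ ∪_f̃ V₂)* → V₂* ∪_f̃* V₁*` that covers the switch map and is given by `j₂ ∘ j₁*` over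
`i₁(X₁ \ Y)`, by `j₂ ∘ f̃* ∘ j₂*` over `i₂(f(Y))` and by `j₁ ∘ j₂*` over `i₂(X₂ \ f(Y))`. -/
def Invertible.GluingDualCommutativity (hG : G.Invertible) : Prop :=
  ∃ Φ : (G.glue hG.injective).Dual ≃ Glue hG.dualGluing.lift,
    DSmooth Φ ∧ DSmooth Φ.symm ∧
    (∀ φ, hG.dualGlue.proj (Φ φ) = hG.switch (hG.glueDual.proj φ)) ∧
    (∀ (x : X₁), x ∉ G.Y → ∀ φ : SmoothDual ((G.glue hG.injective).Fibre (Glue.inl G.f x)),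
      Φ ⟨Glue.inl G.f x, φ⟩ = Glue.inr hG.dualGluing.lift
        ⟨x, SmoothDual.pullback (G.inlFibre hG.injective x) (G.dSmooth_inlFibre _ x) φ⟩) ∧
    (∀ (x : X₂) (hx : x ∈ Set.range G.f)
      (φ : SmoothDual ((G.glue hG.injective).Fibre (Glue.inr G.f x))),
      Φ ⟨Glue.inr G.f x, φ⟩ = Glue.inr hG.dualGluing.lift (hG.dualLift
        ⟨⟨x, SmoothDual.pullback (G.inrFibre hG.injective x) (G.dSmooth_inrFibre _ x) φ⟩, hx⟩)) ∧
    (∀ (x : X₂), x ∉ Set.range G.f →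
      ∀ φ : SmoothDual ((G.glue hG.injective).Fibre (Glue.inr G.f x)),
      Φ ⟨Glue.inr G.f x, φ⟩ = Glue.inl hG.dualGluing.lift
        ⟨x, SmoothDual.pullback (G.inrFibre hG.injective x) (G.dSmooth_inrFibre _ x) φ⟩)

variable (G)

/-- Pseudo-metrics `g₁`, `g₂` are compatible with the gluing along `(f̃, f)`:
`g₁(y)(v, w) = g₂(f(y))(f̃ v, f̃ w)` for `y ∈ Y` and `v, w` in the fibre over `y`. -/
def Compatible (g₁ : P₁.PseudoMetric) (g₂ : P₂.PseudoMetric) : Prop :=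
  ∀ (y : G.Y) (v w : P₁.Fibre y),
    g₁.form y v w = g₂.form (G.f y) (G.fibreMap y _ rfl v) (G.fibreMap y _ rfl w)

variable {G}

/-- The induced pseudo-metrics `g₂*`, `g₁*` are compatible with the gluing along `(f̃*, f⁻¹)`:
`g₁*(f⁻¹(x))(f̃* φ, f̃* ψ) = g₂*(x)(φ, ψ)` for `x ∈ f(Y)` and `φ, ψ` in the dual fibre over `x`. -/
def Invertible.DualCompatible (hG : G.Invertible) (g₁ : P₁.PseudoMetric) (g₂ : P₂.PseudoMetric) :
    Prop :=
  ∀ (x : Set.range G.f) (φ ψ : SmoothDual (P₂.Fibre x)),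
    g₁.dual (G.inv hG.injective x) (hG.dualMap x φ) (hG.dualMap x ψ) = g₂.dual x φ ψ

end Gluing

end Gluing

end PseudoBundle

end

/-! A functional on a fibre of `V₁ ∪_f̃ V₂` restricts along `j₂` to an element of `V₂*` when it sits
over `i₂(X₂)`, and along `j₁` to an element of `V₁*` when it sits over the image of `X₁`. Where both
restrictions exist, the second is `f̃*` of the first, since `v` and `f̃ v` are the same glued
vector. This is exactly the identification made in `V₂* ∪_f̃* V₁*`, so restriction is a well-defined
map `Φ`. It is smooth with no help from the metrics.

The metrics make `f̃*` bijective on dual fibres, although `f̃` itself may be neither injective nor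
surjective. If `f̃* φ = 0`, dual compatibility gives `g₂*(φ, φ) = 0`, and `g₂*` is definite.
Conversely every smooth functional on a fibre of `V₁` is some `g₁(v, ·)`, which by compatibility is
`f̃*` of `g₂(f̃ v, ·)`. Hence `Φ` is bijective.

The substance is smoothness of `Φ⁻¹` on plots coming from `V₁*`: the extended functional has to be
evaluated on plots of `V₂` over `f(Y)`, and `f̃` has no inverse to carry these back. By local
triviality of `V₁`, such a plot is locally `∑ aᵢ g₁(sᵢ, ·)` with smooth `aᵢ` and with plots `sᵢ` of
`V₁` (`PseudoMetric.exists_local_lift`, by Cramer's rule for the Gram matrix). Its extension is `∑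
aᵢ g₂(f̃ sᵢ, ·)` (`Invertible.eval_inr_eq_sum`), which evaluates smoothly by
`PseudoMetric.contDiff_form`. -/

/-! ### Linear algebra of a single pseudo-metric. -/

section LinearAlgebra

/-- Finitely many vectors whose images form a basis of the range of a linear map. -/
theorem LinearMap.exists_basis_range {E W : Type*} [AddCommGroup E] [Module ℝ E]
    [FiniteDimensional ℝ E] [AddCommGroup W] [Module ℝ W] (b : E →ₗ[ℝ] W) :
    ∃ (n : ℕ) (e : Fin n → E), LinearIndependent ℝ (fun i => b (e i)) ∧
      ∀ w, ∃ c : Fin n → ℝ, b w = ∑ i, c i • b (e i) := by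
  let B := Module.finBasis ℝ (LinearMap.range b)
  choose e he using fun i => (B i).2
  refine ⟨_, e, ?_, fun w => ⟨fun i => B.repr ⟨b w, w, rfl⟩ i, ?_⟩⟩
  · simp only [he]
    exact B.linearIndependent.map' (Submodule.subtype _) (Submodule.ker_subtype _)
  · have h := congrArg Subtype.val (B.sum_repr ⟨b w, w, rfl⟩)
    simpa only [he, Submodule.coe_sum, Submodule.coe_smul] using h.symm

variable {E : Type*} [AddCommGroup E] [Module ℝ E] [DiffeologicalSpace E]

theorem IsPseudoMetric.apply_mem {b : LinearMap.BilinForm ℝ E} (hb : IsPseudoMetric b) (v : E) :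
    b v ∈ SmoothDual E :=
  fun n p hp => hb.smooth n (fun u => (v, p u)) ⟨isPlot_const, hp⟩

/-- A pseudo-metric is definite on the quotient by its kernel. -/
theorem IsPseudoMetric.eq_zero_of_apply_self {b : LinearMap.BilinForm ℝ E}
    (hb : IsPseudoMetric b) {v : E} (hv : b v v = 0) : b v = 0 := by
  ext w
  by_contra hw
  -- With `b v v = 0`, the value of `b` at `w - c • v` paired with itself is `b w w - 2 c (b v w)`,
  -- linear in `c`; this `c` makes it `-1`.
  have h1 := hb.nonneg (w - ((b w w + 1) / (2 * b v w)) • v)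
  have hw' : b v w ≠ 0 := hw
  have h2 : b (w - ((b w w + 1) / (2 * b v w)) • v) (w - ((b w w + 1) / (2 * b v w)) • v) =
      -1 := by
    simp only [map_sub, map_smul, LinearMap.sub_apply, LinearMap.smul_apply, smul_eq_mul, hv,
      hb.symm w v]
    field_simp
    ring
  linarith

/-- Vectors `e i` with invertible Gram matrix that detect all smooth functionals. -/
theorem IsPseudoMetric.exists_frame [FiniteDimensional ℝ E] {b : LinearMap.BilinForm ℝ E}
    (hb : IsPseudoMetric b) : ∃ (n : ℕ) (e : Fin n → E),
      (Matrix.of fun i j => b (e i) (e j)).det ≠ 0 ∧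
        ∀ ψ ∈ SmoothDual E, (∀ j, ψ (e j) = 0) → ψ = 0 := by
  obtain ⟨n, e, hli, hsp⟩ := b.exists_basis_range
  -- The `b (e i)` span the range of `b`, so by symmetry `b u` is determined by its values on the `e
  -- j`.
  have key : ∀ u, (∀ j, b u (e j) = 0) → b u = 0 := by
    intro u hu
    ext w
    obtain ⟨c, hc⟩ := hsp w
    rw [hb.symm, hc, LinearMap.zero_apply, LinearMap.sum_apply]
    exact Finset.sum_eq_zero fun i _ => by rw [LinearMap.smul_apply, hb.symm, hu, smul_zero]
  refine ⟨_, e, fun hdet => ?_, fun ψ hψ h => ?_⟩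
  -- A null vector `a` of the Gram matrix gives a combination `∑ a i • e i` orthogonal to every `e
  -- j`, hence in the kernel of `b`, against independence of the `b (e i)`.
  · obtain ⟨a, ha, h⟩ := Matrix.exists_vecMul_eq_zero_iff.mpr hdet
    have h1 : b (∑ i, a i • e i) = 0 := key _ fun j => by
      have := congrFun h j
      simpa [Matrix.vecMul, dotProduct] using this
    refine ha (funext fun i => ?_)
    exact Fintype.linearIndependent_iff.mp hli a (by simpa only [map_sum, map_smul] using h1) i
  · obtain ⟨u, hu⟩ := hb.exists_eq ⟨ψ, hψ⟩
    have hu' : b u = ψ := hu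
    rw [← hu']
    exact key u fun j => by rw [hu', h]

end LinearAlgebra

namespace PseudoBundle

variable {V X : Type*} [DiffeologicalSpace V] [DiffeologicalSpace X] {P : PseudoBundle V X}

/-! ### Smoothness of pseudo-metrics along plots -/

/-- The value of an element of `V* ⊗ V*` on a pair of vectors of the corresponding fibre. -/
def DualTensor.eval (T : P.DualTensor) (v w : V) (hv : P.proj v = T.base)
    (hw : P.proj w = T.base) : ℝ :=
  tensorForm T.tensor ⟨v, hv⟩ ⟨w, hw⟩

theorem DualTensor.eval_congr {T T' : P.DualTensor} {v v' w w' : V} (hT : T = T') (h1 : v = v')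
    (h2 : w = w') (hv : P.proj v = T.base) (hw : P.proj w = T.base)
    (hv' : P.proj v' = T'.base) (hw' : P.proj w' = T'.base) :
    T.eval v w hv hw = T'.eval v' w' hv' hw' := by
  subst hT h1 h2
  rfl

variable (P) in
/-- The diffeology on `V* ⊗ V*` whose plots evaluate smoothly on pairs of plots of `V`. -/
@[reducible]
def DualTensor.evalDiffeology : DiffeologicalSpace P.DualTensor where
  plots l := {q | IsPlot (fun u => (q u).base) ∧
    ∀ (k : ℕ) (a : Eucl k → Eucl l) (v w : Eucl k → V), ContDiff ℝ ∞ a → IsPlot v → IsPlot w →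
      ∀ (hv : ∀ t, P.proj (v t) = (q (a t)).base) (hw : ∀ t, P.proj (w t) = (q (a t)).base),
        ContDiff ℝ ∞ (fun t => (q (a t)).eval (v t) (w t) (hv t) (hw t))}
  constant_plots T := ⟨isPlot_const, fun k a v w _ hv hw hv' hw' => by
    -- A tensor is a finite sum of pure tensors, on which the evaluation is a product of two smooth
    -- functionals.
    have key : ∀ τ : SmoothDual (P.Fibre T.base) ⊗[ℝ] SmoothDual (P.Fibre T.base),
        ContDiff ℝ ∞ fun t => tensorForm τ ⟨v t, hv' t⟩ ⟨w t, hw' t⟩ := by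
      intro τ
      induction τ using TensorProduct.induction_on with
      | zero => simpa using contDiff_const
      | tmul φ ψ =>
        simp only [tensorForm_tmul]
        exact (φ.2 k (fun t => ⟨v t, hv' t⟩) hv).contDiff.mul
          (ψ.2 k (fun t => ⟨w t, hw' t⟩) hw).contDiff
      | add τ τ' h h' =>
        simp only [map_add, LinearMap.add_apply]
        exact h.add h'
    exact key T.tensor⟩
  plot_reparam hq hf := ⟨isPlot_reparam hq.1 hf, fun k a v w ha hv hw hv' hw' =>
    hq.2 k _ v w (hf.comp ha) hv hw hv' hw'⟩
  locality {n q} hq := by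
    refine ⟨DiffeologicalSpace.locality fun x => ?_, ?_⟩
    · obtain ⟨u, hu, hx, h⟩ := hq x
      exact ⟨u, hu, hx, fun {m f} h1 h2 => (h h1 h2).1⟩
    · intro k a v w ha hv hw hv' hw'
      refine contDiff_iff_contDiffAt.mpr fun t => ?_
      obtain ⟨u, hu, hx, hloc⟩ := hq (a t)
      obtain ⟨c, hc, hcu, hct⟩ :=
        exists_smooth_cutoff (hu.preimage ha.continuous) (x := t) hx
      have h1 := (hloc (f := a ∘ c) hcu (ha.comp hc)).2 k id _ _ contDiff_id
        (isPlot_reparam hv hc) (isPlot_reparam hw hc) (fun s => hv' (c s)) (fun s => hw' (c s))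
      refine h1.contDiffAt.congr_of_eventuallyEq ?_
      filter_upwards [hct] with s hs
      exact DualTensor.eval_congr (by simp [hs]) (by simp [hs]) (by simp [hs]) _ _ _ _

/-- The tensor product diffeology is the infimum of the admissible ones, so its plots are plots of
each of them. Admissibility here therefore transfers smooth evaluation to every smooth section of
`V* ⊗ V*`. -/
theorem DualTensor.isAdmissible_evalDiffeology :
    DualTensor.IsAdmissible P (DualTensor.evalDiffeology P) :=
  letI := DualTensor.evalDiffeology P
  { smooth_base := fun _ _ hq => hq.1
    smooth_add := fun n b s t hs ht => ⟨hs.1, fun k a v w ha hv hw hv' hw' => by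
      simp only [DualTensor.eval, map_add, LinearMap.add_apply]
      exact (hs.2 k a v w ha hv hw hv' hw').add (ht.2 k a v w ha hv hw hv' hw')⟩
    smooth_smul := fun n q hq => ⟨hq.2.1, fun k a v w ha hv hw hv' hw' => by
      have h := (hq.1.contDiff.comp ha).mul (hq.2.2 k a v w ha hv hw hv' hw')
      simpa only [DualTensor.eval, Function.comp_apply, map_smul, LinearMap.smul_apply,
        smul_eq_mul] using h⟩
    smooth_zero := fun n b hb => ⟨hb, fun k a v w ha hv hw hv' hw' => by
      simpa [DualTensor.eval] using contDiff_const⟩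
    smooth_tmul := fun n b φ ψ hφ hψ => ⟨hφ.1, fun k a v w ha hv hw hv' hw' => by
      simp only [DualTensor.eval, tensorForm_tmul]
      exact (IsDualPlot.contDiff hφ ha hv hv').mul (IsDualPlot.contDiff hψ ha hw hw')⟩ }

/-- A pseudo-metric evaluates smoothly on plots of `V` over the same plot of `X`. -/
theorem PseudoMetric.contDiff_form (g : P.PseudoMetric) {k : ℕ} {c : Eucl k → X}
    {v w : ∀ t, P.Fibre (c t)} (hv : IsPlot fun t => (v t).1) (hw : IsPlot fun t => (w t).1) :
    ContDiff ℝ ∞ fun t => g.form (c t) (v t) (w t) := by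
  have hc : IsPlot c := by
    have := P.smooth_proj _ _ hv
    rwa [show P.proj ∘ (fun t => (v t).1) = c from funext fun t => (v t).2] at this
  have h := DiffeologicalSpace.isPlot_sInf_iff.mp (g.smooth k c hc) (DualTensor.evalDiffeology P)
    DualTensor.isAdmissible_evalDiffeology
  exact h.2 k id _ _ contDiff_id hv hw (fun t => (v t).2) (fun t => (w t).2)

theorem PseudoMetric.form_congr (g : P.PseudoMetric) {x x' : X} (hx : x = x') {v w : P.Fibre x}
    {v' w' : P.Fibre x'} (hv : v.1 = v'.1) (hw : w.1 = w'.1) :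
    g.form x v w = g.form x' v' w' := by
  subst hx
  rw [Subtype.ext hv, Subtype.ext hw]

/-! ### Local frames -/

/-- A locally trivial pseudo-bundle is, near `x`, a product with the fibre over `x`. -/
theorem LocallyTrivial.exists_fibre_equiv (hlt : P.LocallyTrivial) (x : X) :
    ∃ U : Set X, IsOpen[dTopology] U ∧ x ∈ U ∧ ∃ L : ∀ y : U, P.Fibre x ≃ₗ[ℝ] P.Fibre y,
      (∀ (y : U), (y : X) = x → ∀ v, (L y v).1 = v.1) ∧
      ∀ {k : ℕ} {c : Eucl k → U} {v : Eucl k → P.Fibre x}, IsPlot c → IsPlot v →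
        IsPlot fun t => (L (c t) (v t)).1 := by
  obtain ⟨U, hU, hx, e, he, he', hproj, hlin⟩ := hlt x
  have hb : ∀ (y : U) (f : P.Fibre x), P.proj (e.symm (y, f)).1 = y := fun y f => by
    rw [← hproj, e.apply_symm_apply]
  let S : ∀ y : U, P.Fibre y ≃ₗ[ℝ] P.Fibre x := fun y =>
    { toFun := fun v => (e ⟨v.1, v.2.symm ▸ y.2⟩).2
      map_add' := (hlin y).map_add
      map_smul' := (hlin y).map_smul
      invFun := fun f => ⟨(e.symm (y, f)).1, hb y f⟩
      left_inv := fun v => by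
        have h : (y, (e ⟨v.1, v.2.symm ▸ y.2⟩).2) = e ⟨v.1, v.2.symm ▸ y.2⟩ :=
          Prod.ext (Subtype.ext (v.2.symm.trans (hproj ⟨v.1, v.2.symm ▸ y.2⟩).symm)) rfl
        apply Subtype.ext
        change (e.symm (y, (e ⟨v.1, v.2.symm ▸ y.2⟩).2)).1 = v.1
        rw [h, e.symm_apply_apply]
      right_inv := fun f => by
        change (e ⟨(e.symm (y, f)).1, _⟩).2 = f
        rw [Subtype.coe_eta, e.apply_symm_apply] }
  -- The trivialisation need not be the identity on the fibre over `x`; composing with its value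
  -- there normalises `L` to be the identity at `x`.
  refine ⟨U, hU, hx, fun y => (S ⟨x, hx⟩).trans (S y).symm, ?_, ?_⟩
  · rintro ⟨y, hy⟩ rfl v
    exact congrArg Subtype.val ((S ⟨y, hy⟩).symm_apply_apply v)
  · intro k c v hc hv
    exact he' k (fun t => (c t, (e ⟨(v t).1, (v t).2.symm ▸ hx⟩).2))
      ⟨hc, (he k (fun t => ⟨(v t).1, (v t).2.symm ▸ hx⟩) hv).2⟩

/-- Near any parameter, the fibres along a plot of the base have smooth families of vectors that
detect smooth functionals and whose Gram matrix is invertible at the given parameter. -/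
theorem PseudoMetric.exists_local_frame (hfd : P.FiniteDim) (hlt : P.LocallyTrivial)
    (g : P.PseudoMetric) {k : ℕ} {c : Eucl k → X} (hc : IsPlot c) (t₀ : Eucl k) :
    ∃ κ : Eucl k → Eucl k, ContDiff ℝ ∞ κ ∧ (∀ᶠ t in 𝓝 t₀, κ t = t) ∧
      ∃ (n : ℕ) (s : Fin n → ∀ t, P.Fibre (c (κ t))), (∀ i, IsPlot fun t => (s i t).1) ∧
        (Matrix.of fun i j => g.form _ (s i t₀) (s j t₀)).det ≠ 0 ∧
        ∀ t, ∀ ψ ∈ SmoothDual (P.Fibre (c (κ t))), (∀ j, ψ (s j t) = 0) → ψ = 0 := by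
  obtain ⟨U, hU, hx, L, hL, hLp⟩ := hlt.exists_fibre_equiv (c t₀)
  -- A D-open set has open preimage under the plot `c`, so a cutoff `κ` keeps `c ∘ κ` inside the
  -- trivialising set for all parameters.
  obtain ⟨κ, hκ, hκU, hκt⟩ :=
    exists_smooth_cutoff (isOpen_iff_preimages_plots.mp hU k c hc) (x := t₀) hx
  have := hfd (c t₀)
  obtain ⟨n, e, hdet, he⟩ := (g.isPseudoMetric (c t₀)).exists_frame
  refine ⟨κ, hκ, hκt, n, fun i t => L ⟨c (κ t), hκU t⟩ (e i),
    fun i => hLp (c := fun t => ⟨c (κ t), hκU t⟩) (isPlot_reparam hc hκ) isPlot_const, ?_, ?_⟩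
  · have h0 : c (κ t₀) = c t₀ := by rw [hκt.self_of_nhds]
    convert! hdet using 3
    funext i
    funext j
    exact g.form_congr h0 (hL _ h0 _) (hL _ h0 _)
  · intro t ψ hψ h
    -- Pulled back by the smooth isomorphism `L`, `ψ` becomes a smooth functional on the fixed fibre
    -- over `c t₀`, where the `e j` detect it. So detection holds at every `t`, while the Gram
    -- determinant is controlled only at `t₀`.
    have h1 : ψ ∘ₗ (L ⟨c (κ t), hκU t⟩).toLinearMap = 0 := by
      refine he _ (fun m p hp => ?_) h
      exact hψ m (fun u => L ⟨c (κ t), hκU t⟩ (p u))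
        (hLp (c := fun _ => ⟨c (κ t), hκU t⟩) isPlot_const hp)
    ext v
    simpa using LinearMap.congr_fun h1 ((L ⟨c (κ t), hκU t⟩).symm v)

theorem _root_.ContDiffAt.matrix_det {W : Type*} [NormedAddCommGroup W] [NormedSpace ℝ W] {n : ℕ}
    {M : W → Matrix (Fin n) (Fin n) ℝ} {t : W}
    (hM : ∀ i j, ContDiffAt ℝ ∞ (fun t => M t i j) t) :
    ContDiffAt ℝ ∞ (fun t => (M t).det) t := by
  simp only [Matrix.det_apply']
  exact ContDiffAt.sum fun σ _ => contDiffAt_const.mul (contDiffAt_prod fun i _ => hM _ _)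

/-- Locally, a plot of `V*` is the image under `g` of a linear combination, with smooth
coefficients, of plots of `V`. -/
theorem PseudoMetric.exists_local_lift (hfd : P.FiniteDim) (hlt : P.LocallyTrivial)
    (g : P.PseudoMetric) {k : ℕ} {q : Eucl k → P.Dual} (hq : IsPlot q) (t₀ : Eucl k) :
    ∃ κ : Eucl k → Eucl k, ContDiff ℝ ∞ κ ∧ (∀ᶠ t in 𝓝 t₀, κ t = t) ∧
      ∃ (n : ℕ) (s : Fin n → ∀ t, P.Fibre (q (κ t)).base) (a : Fin n → Eucl k → ℝ),
        (∀ i, IsPlot fun t => (s i t).1) ∧ (∀ i, ContDiffAt ℝ ∞ (a i) t₀) ∧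
        ∀ᶠ t in 𝓝 t₀, (q (κ t)).functional.1 = ∑ i, a i t • g.form _ (s i t) := by
  obtain ⟨κ, hκ, hκt, n, s, hs, hdet, h⟩ := g.exists_local_frame hfd hlt hq.1 t₀
  -- The indices are arranged so that `∑ aᵢ g(sᵢ, ·)` takes the values `f` on the frame exactly when
  -- `M a = f`.
  let M : Eucl k → Matrix (Fin n) (Fin n) ℝ := fun t =>
    Matrix.of fun i j => g.form _ (s j t) (s i t)
  have hM : ∀ i j, ContDiffAt ℝ ∞ (fun t => M t i j) t₀ := fun i j =>
    (g.contDiff_form (hs j) (hs i)).contDiffAt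
  let f : Eucl k → Fin n → ℝ := fun t j => (q (κ t)).functional.1 (s j t)
  have hf : ∀ j, ContDiffAt ℝ ∞ (fun t => f t j) t₀ := fun j =>
    (IsDualPlot.contDiff hq hκ (hs j) (fun t => (s j t).2)).contDiffAt
  have hdet0 : (M t₀).det ≠ 0 := by
    rw [← Matrix.det_transpose]
    exact hdet
  have hdetM := ContDiffAt.matrix_det hM
  -- Cramer's rule: this solves `M a = f` wherever `det M ≠ 0`, and it is a rational expression in
  -- functions smooth at `t₀`.
  refine ⟨κ, hκ, hκt, n, s, fun i t => (M t).det⁻¹ * (M t).cramer (f t) i, hs, fun i => ?_, ?_⟩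
  · refine (hdetM.inv hdet0).mul ?_
    simp only [Matrix.cramer_apply]
    refine ContDiffAt.matrix_det fun j l => ?_
    by_cases hl : l = i
    · subst hl
      simpa using hf j
    · simpa [Matrix.updateCol_ne hl] using hM j l
  · filter_upwards [hdetM.continuousAt.eventually_ne hdet0] with t ht
    -- Both sides are smooth functionals, so it is enough to compare them on the frame vectors.
    refine sub_eq_zero.mp (h t _ ?_ fun j => ?_)
    · exact Submodule.sub_mem _ (q (κ t)).functional.2 (Submodule.sum_mem _ fun i _ =>
        Submodule.smul_mem _ _ ((g.isPseudoMetric _).apply_mem _))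
    · have h1 := congrFun (Matrix.mulVec_cramer (M t) (f t)) j
      have h2 : ∑ i, M t j i * (M t).cramer (f t) i = (M t).det * f t j := h1
      have h3 : ∑ i, ((M t).det⁻¹ * (M t).cramer (f t) i) * M t j i = f t j := by
        rw [← inv_mul_cancel_left₀ ht (f t j), ← h2, Finset.mul_sum]
        exact Finset.sum_congr rfl fun i _ => by ring
      simp only [LinearMap.sub_apply, LinearMap.sum_apply, LinearMap.smul_apply, smul_eq_mul]
      exact sub_eq_zero.mpr h3.symm

end PseudoBundle
-- Points of a gluing, lifts of its plots, and equality of functionals.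
theorem Glue.inr_injective {X₁ X₂ : Type*} {Y : Set X₁} (f : Y → X₂) :
    Function.Injective (Glue.inr f) := fun _ _ h =>
  Sum.inr_injective (congrArg (Glue.nf f) h)

theorem Glue.inl_injective {X₁ X₂ : Type*} {Y : Set X₁} {f : Y → X₂}
    (hf : Function.Injective f) : Function.Injective (Glue.inl f) := by
  classical
  intro x x' h
  have key : ∀ x, Glue.nf f (Glue.inl f x) =
      if h : x ∈ Y then Sum.inr (f ⟨x, h⟩) else Sum.inl ⟨x, h⟩ := fun x => by
    by_cases hx : x ∈ Y
    · rw [dif_pos hx, show Glue.inl f x = _ from Glue.inl_eq_inr f ⟨x, hx⟩, Glue.nf_inr]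
    · rw [dif_neg hx, Glue.nf_inl f hx]
  have h1 := congrArg (Glue.nf f) h
  rw [key, key] at h1
  split_ifs at h1
  · exact congrArg Subtype.val (hf (Sum.inr_injective h1))
  · exact congrArg Subtype.val (Sum.inl_injective h1)

theorem Glue.inr_or_inl {X₁ X₂ : Type*} {Y : Set X₁} (f : Y → X₂) (z : Glue f) :
    (∃ x, Glue.inr f x = z) ∨ ∃ x, x ∉ Y ∧ Glue.inl f x = z := by
  have h := Glue.ofNf_nf f z
  rcases hs : Glue.nf f z with x | x <;> rw [hs] at h
  · exact Or.inr ⟨x.1, x.2, h⟩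
  · exact Or.inl ⟨x, h⟩

/-- Near a given parameter, a plot of `X₁ ∪_f X₂` can be reparametrised so that it lifts. -/
theorem Glue.exists_lift_reparam {X₁ X₂ : Type*} {Y : Set X₁} [DiffeologicalSpace X₁]
    [DiffeologicalSpace X₂] (f : Y → X₂) {n : ℕ} {p : Eucl n → Glue f} (hp : IsPlot p)
    (t₀ : Eucl n) : ∃ κ : Eucl n → Eucl n, ContDiff ℝ ∞ κ ∧ (∀ᶠ t in 𝓝 t₀, κ t = t) ∧
      ((∃ q : Eucl n → X₁, IsPlot q ∧ ∀ t, p (κ t) = Glue.inl f (q t)) ∨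
        ∃ q : Eucl n → X₂, IsPlot q ∧ ∀ t, p (κ t) = Glue.inr f (q t)) := by
  rcases Glue.exists_lift f hp t₀ with ⟨q, hq, h⟩ | ⟨q, hq, h⟩ <;>
  obtain ⟨u, hu, huo, htu⟩ := eventually_nhds_iff.mp h <;>
  obtain ⟨κ, hκ, hκu, hκt⟩ := exists_smooth_cutoff huo htu
  · exact ⟨κ, hκ, hκt, Or.inl ⟨q ∘ κ, isPlot_reparam hq hκ, fun t => hu _ (hκu t)⟩⟩
  · exact ⟨κ, hκ, hκt, Or.inr ⟨q ∘ κ, isPlot_reparam hq hκ, fun t => hu _ (hκu t)⟩⟩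

theorem contDiff_of_forall_eq {k : ℕ} {f g : Eucl k → ℝ} (hf : ContDiff ℝ ∞ f)
    (h : ∀ t, g t = f t) : ContDiff ℝ ∞ g :=
  (funext h : g = f) ▸ hf

namespace PseudoBundle

theorem Dual.ext_eval {V X : Type*} [DiffeologicalSpace V] [DiffeologicalSpace X]
    {P : PseudoBundle V X} {φ ψ : P.Dual} (hb : φ.base = ψ.base)
    (h : ∀ v hv hv', φ.eval v hv = ψ.eval v hv') : φ = ψ := by
  obtain ⟨x, φ⟩ := φ
  obtain ⟨y, ψ⟩ := ψ
  obtain rfl : x = y := hb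
  congr 1
  exact Subtype.ext (LinearMap.ext fun v => h v.1 v.2 v.2)

namespace Gluing

variable {V₁ X₁ V₂ X₂ : Type*} [DiffeologicalSpace V₁] [DiffeologicalSpace X₁]
  [DiffeologicalSpace V₂] [DiffeologicalSpace X₂]
  {P₁ : PseudoBundle V₁ X₁} {P₂ : PseudoBundle V₂ X₂} {G : Gluing P₁ P₂}

/-! ### The dual map on fibres -/

/-- The target is a free `x` with `f y = x`, so that the identity applies at `y = f⁻¹(x)`, where `f
(f⁻¹ x) = x` is only propositional. -/
theorem Compatible.form_eq {g₁ : P₁.PseudoMetric} {g₂ : P₂.PseudoMetric}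
    (hg : G.Compatible g₁ g₂) (y : G.Y) (x : X₂) (h : G.f y = x) (v w : P₁.Fibre y) :
    g₁.form y v w = g₂.form x (G.fibreMap y x h v) (G.fibreMap y x h w) := by
  subst h
  exact hg y v w

/-- Writing `φ = g₂(v, ·)`, dual compatibility turns `f̃* φ = 0` into `g₂(v, v) = 0`.
Semi-definiteness then forces `g₂(v, ·) = 0`. -/
theorem Invertible.DualCompatible.injective_dualMap (hfd₂ : P₂.FiniteDim) {hG : G.Invertible}
    {g₁ : P₁.PseudoMetric} {g₂ : P₂.PseudoMetric} (hg' : hG.DualCompatible g₁ g₂)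
    (x : Set.range G.f) : Function.Injective (hG.dualMap x) := by
  refine (injective_iff_map_eq_zero _).mpr fun φ hφ => ?_
  have := hfd₂ x
  obtain ⟨v, hv⟩ := (g₂.isPseudoMetric x).exists_eq φ
  have h := hg' x φ φ
  have h1 : g₁.dual _ (0 : SmoothDual (P₁.Fibre (G.inv hG.injective x))) 0 = 0 :=
    (dualForm_eq (g₁.isPseudoMetric _).symm (v := 0) (w := 0) (map_zero _) (map_zero _)).trans
      (by simp)
  have h2 : g₂.dual x φ φ = tensorForm (g₂.toFun x) v v :=
    dualForm_eq (g₂.isPseudoMetric _).symm hv hv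
  rw [hφ, h1, h2] at h
  exact Subtype.ext (hv.symm.trans ((g₂.isPseudoMetric x).eq_zero_of_apply_self h.symm))

/-- A smooth functional `g₁(v, ·)` is the pullback of `g₂(f̃ v, ·)`; this is compatibility read with
one argument fixed. -/
theorem Compatible.surjective_dualMap (hfd₁ : P₁.FiniteDim) (hG : G.Invertible)
    {g₁ : P₁.PseudoMetric} {g₂ : P₂.PseudoMetric} (hg : G.Compatible g₁ g₂)
    (x : Set.range G.f) : Function.Surjective (hG.dualMap x) := by
  intro ψ
  have := hfd₁ (G.inv hG.injective x)
  obtain ⟨v, hv⟩ := (g₁.isPseudoMetric _).exists_eq ψ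
  refine ⟨⟨_, (g₂.isPseudoMetric x).apply_mem
    (G.fibreMap _ x (G.f_inv hG.injective x) v)⟩, Subtype.ext (LinearMap.ext fun w => ?_)⟩
  rw [← hv]
  exact (hg.form_eq _ x (G.f_inv hG.injective x) v w).symm

/-- Moves injectivity of `f̃*` from points of `f(Y)` to points of `Y`, the form needed when the
functional on `V₁` is what is given. -/
theorem Invertible.pullback_fibreMap_injective {hG : G.Invertible}
    (hinj : ∀ x, Function.Injective (hG.dualMap x)) (y : G.Y) (x : X₂) (h : G.f y = x) :
    Function.Injective (SmoothDual.pullback (G.fibreMap y x h) (G.dSmooth_fibreMap y x h)) := by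
  have key : ∀ (x : Set.range G.f) (y : G.Y) (h : G.f y = x), G.inv hG.injective x = y →
      Function.Injective
        (SmoothDual.pullback (G.fibreMap y x h) (G.dSmooth_fibreMap y x h)) := by
    rintro x _ h rfl
    exact hinj x
  subst h
  exact key ⟨G.f y, y, rfl⟩ y rfl (G.inv_f _ y)

/-! ### Restricting functionals to the two terms of a gluing -/

variable (hf : Function.Injective G.f)

/-- The map `j₁` on the fibre over `x`, with values in the fibre over `z = i₁ x`. -/
def fibreInlTo (x : X₁) (z : Glue G.f) (h : Glue.inl G.f x = z) :
    P₁.Fibre x →ₗ[ℝ] (G.glue hf).Fibre z where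
  toFun v := ⟨Glue.inl G.lift v.1, (G.fibreInl x v).2.trans h⟩
  map_add' v w := by
    subst h
    exact (G.isLinearMap_fibreInl x).map_add v w
  map_smul' c v := by
    subst h
    exact (G.isLinearMap_fibreInl x).map_smul c v

/-- The map `j₂` on the fibre over `x`, with values in the fibre over `z = i₂ x`. -/
def fibreInrTo (x : X₂) (z : Glue G.f) (h : Glue.inr G.f x = z) :
    P₂.Fibre x →ₗ[ℝ] (G.glue hf).Fibre z where
  toFun v := ⟨Glue.inr G.lift v.1, (G.fibreInr x v).2.trans h⟩
  map_add' v w := by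
    subst h
    exact (G.isLinearMap_fibreInr x).map_add v w
  map_smul' c v := by
    subst h
    exact (G.isLinearMap_fibreInr x).map_smul c v

variable {hf}

/-- The restriction `j₁*` of an element of `(V₁ ∪_f̃ V₂)*` to `V₁`. -/
noncomputable def restrictInl (d : (G.glue hf).Dual) (x : X₁) (h : Glue.inl G.f x = d.base) : P₁.Dual :=
  ⟨x, SmoothDual.pullback (G.fibreInlTo hf x d.base h)
    (fun n p hp => Glue.dSmooth_inl G.lift n (fun u => (p u).1) hp) d.functional⟩

/-- The restriction `j₂*` of an element of `(V₁ ∪_f̃ V₂)*` to `V₂`. -/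
noncomputable def restrictInr (d : (G.glue hf).Dual) (x : X₂) (h : Glue.inr G.f x = d.base) : P₂.Dual :=
  ⟨x, SmoothDual.pullback (G.fibreInrTo hf x d.base h)
    (fun n p hp => Glue.dSmooth_inr G.lift n (fun u => (p u).1) hp) d.functional⟩

/-- The restriction is called `r` so that `v` need only lie over `r.base`; this suits a prescribed
`r` known to be the restriction of `d`. -/
theorem eval_inl (d : (G.glue hf).Dual) {r : P₁.Dual} {x : X₁} {h : Glue.inl G.f x = d.base}
    (hr : restrictInl d x h = r) {v : V₁} (hv : P₁.proj v = r.base)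
    (hv' : (G.glue hf).proj (Glue.inl G.lift v) = d.base) :
    d.eval (Glue.inl G.lift v) hv' = r.eval v hv := by
  subst hr
  rfl

theorem eval_inr (d : (G.glue hf).Dual) {r : P₂.Dual} {x : X₂} {h : Glue.inr G.f x = d.base}
    (hr : restrictInr d x h = r) {v : V₂} (hv : P₂.proj v = r.base)
    (hv' : (G.glue hf).proj (Glue.inr G.lift v) = d.base) :
    d.eval (Glue.inr G.lift v) hv' = r.eval v hv := by
  subst hr
  rfl

theorem eq_of_restrictInr {d d' : (G.glue hf).Dual} {x : X₂} (h : Glue.inr G.f x = d.base)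
    (h' : Glue.inr G.f x = d'.base) (hr : restrictInr d x h = restrictInr d' x h') : d = d' := by
  refine Dual.ext_eval (h.symm.trans h') fun v hv hv' => ?_
  obtain ⟨w, hw⟩ := (G.bijective_fibreInr x).2 ⟨v, hv.trans h.symm⟩
  obtain rfl : Glue.inr G.lift w.1 = v := congrArg Subtype.val hw
  exact (eval_inr d hr w.2 hv).trans (eval_inr d' rfl w.2 hv').symm

/-- Outside `Y` the map `j₁` is onto the glued fibre. Over `Y` the glued fibre is that of `V₂`, and
`f̃` need not reach all of it. -/
theorem eq_of_restrictInl {d d' : (G.glue hf).Dual} {x : X₁} (hx : x ∉ G.Y)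
    (h : Glue.inl G.f x = d.base) (h' : Glue.inl G.f x = d'.base)
    (hr : restrictInl d x h = restrictInl d' x h') : d = d' := by
  refine Dual.ext_eval (h.symm.trans h') fun v hv hv' => ?_
  obtain ⟨w, hw⟩ := (G.bijective_fibreInl hx).2 ⟨v, hv.trans h.symm⟩
  obtain rfl : Glue.inl G.lift w.1 = v := congrArg Subtype.val hw
  exact (eval_inl d hr w.2 hv).trans (eval_inl d' rfl w.2 hv').symm

/-- Over `f(Y)`, the restrictions to the two terms are related by `f̃*`. -/
theorem Invertible.dualLift_restrictInr (hG : G.Invertible) (d : (G.glue hG.injective).Dual)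
    {x : X₁} (h : Glue.inl G.f x = d.base) {x' : X₂} (h' : Glue.inr G.f x' = d.base)
    (hx' : x' ∈ Set.range G.f) :
    hG.dualLift ⟨restrictInr d x' h', hx'⟩ = restrictInl d x h := by
  obtain ⟨hx, rfl⟩ := G.mem_of_glue_eq (h.trans h'.symm)
  refine Dual.ext_eval (congrArg Subtype.val (G.inv_f hG.injective ⟨x, hx⟩)) fun v hv hv' => ?_
  -- Both functionals evaluate `d`, one at `f̃ v` and the other at `v`, and these are the same glued
  -- vector.
  have hvw := Glue.inl_eq_inr G.lift ⟨v, mem_of_fibre (π := P₁.proj) ⟨v, hv'⟩ hx⟩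
  exact Dual.eval_congr (φ := d) (ψ := d) rfl hvw.symm _ _

/-! ### Smoothness for functionals on a gluing -/

/-- Smoothness is local, and near each parameter a plot of the glued space lifts to one of the two
terms. `isPlot_glueDual` is the same argument for families of functionals. -/
theorem dSmooth_of_inl_inr {z : Glue G.f} {ψ : (G.glue hf).Fibre z → ℝ}
    (h₁ : ∀ (k : ℕ) (p : Eucl k → V₁), IsPlot p → ∀ h : ∀ t, Glue.inl G.f (P₁.proj (p t)) = z,
      ContDiff ℝ ∞ fun t => ψ ⟨Glue.inl G.lift (p t), h t⟩)
    (h₂ : ∀ (k : ℕ) (p : Eucl k → V₂), IsPlot p → ∀ h : ∀ t, Glue.inr G.f (P₂.proj (p t)) = z,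
      ContDiff ℝ ∞ fun t => ψ ⟨Glue.inr G.lift (p t), h t⟩) : DSmooth ψ := by
  intro k p hp
  refine ContDiff.isPlot (contDiff_iff_contDiffAt.mpr fun t₀ => ?_)
  have hp' : IsPlot fun t => (p t).1 := hp
  obtain ⟨κ, hκ, hκt, ⟨q, hq, h⟩ | ⟨q, hq, h⟩⟩ := Glue.exists_lift_reparam _ hp' t₀
  · have hz : ∀ t, Glue.inl G.f (P₁.proj (q t)) = z := fun t =>
      (congrArg G.glueProj (h t)).symm.trans (p (κ t)).2
    refine (h₁ k q hq hz).contDiffAt.congr_of_eventuallyEq ?_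
    filter_upwards [hκt] with t ht
    exact congrArg ψ (Subtype.ext ((congrArg (fun s => (p s).1) ht.symm).trans (h t)))
  · have hz : ∀ t, Glue.inr G.f (P₂.proj (q t)) = z := fun t =>
      (congrArg G.glueProj (h t)).symm.trans (p (κ t)).2
    refine (h₂ k q hq hz).contDiffAt.congr_of_eventuallyEq ?_
    filter_upwards [hκt] with t ht
    exact congrArg ψ (Subtype.ext ((congrArg (fun s => (p s).1) ht.symm).trans (h t)))

theorem isPlot_glueDual {n : ℕ} {d : Eucl n → (G.glue hf).Dual}
    (hb : IsPlot fun u => (d u).base)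
    (h₁ : ∀ (k : ℕ) (a : Eucl k → Eucl n) (p : Eucl k → V₁), ContDiff ℝ ∞ a → IsPlot p →
      ∀ h : ∀ t, Glue.inl G.f (P₁.proj (p t)) = (d (a t)).base,
        ContDiff ℝ ∞ fun t => (d (a t)).eval (Glue.inl G.lift (p t)) (h t))
    (h₂ : ∀ (k : ℕ) (a : Eucl k → Eucl n) (p : Eucl k → V₂), ContDiff ℝ ∞ a → IsPlot p →
      ∀ h : ∀ t, Glue.inr G.f (P₂.proj (p t)) = (d (a t)).base,
        ContDiff ℝ ∞ fun t => (d (a t)).eval (Glue.inr G.lift (p t)) (h t)) : IsPlot d := by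
  refine isDualPlot_of_contDiff hb fun k a p ha hp hpd => ?_
  refine contDiff_iff_contDiffAt.mpr fun t₀ => ?_
  obtain ⟨κ, hκ, hκt, ⟨q, hq, h⟩ | ⟨q, hq, h⟩⟩ := Glue.exists_lift_reparam _ hp t₀
  · have hz : ∀ t, Glue.inl G.f (P₁.proj (q t)) = (d (a (κ t))).base := fun t =>
      (congrArg G.glueProj (h t)).symm.trans (hpd (κ t))
    refine (h₁ k _ q (ha.comp hκ) hq hz).contDiffAt.congr_of_eventuallyEq ?_
    filter_upwards [hκt] with t ht
    exact Dual.eval_congr (by simp only [Function.comp_apply, ht]) (by rw [← h t, ht]) _ _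
  · have hz : ∀ t, Glue.inr G.f (P₂.proj (q t)) = (d (a (κ t))).base := fun t =>
      (congrArg G.glueProj (h t)).symm.trans (hpd (κ t))
    refine (h₂ k _ q (ha.comp hκ) hq hz).contDiffAt.congr_of_eventuallyEq ?_
    filter_upwards [hκt] with t ht
    exact Dual.eval_congr (by simp only [Function.comp_apply, ht]) (by rw [← h t, ht]) _ _

/-! ### Extending functionals from the two terms of a gluing -/

/-- The fibre over `i₂ x` is that of `V₂`, so `φ` transports along `j₂`; it stays smooth on plots
from `V₁` because they enter the fibre through the smooth map `f̃`. -/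
theorem exists_restrictInr_eq (hf : Function.Injective G.f) (r : P₂.Dual) :
    ∃ (d : (G.glue hf).Dual) (h : Glue.inr G.f r.base = d.base), restrictInr d r.base h = r := by
  obtain ⟨x, φ⟩ := r
  let e := LinearEquiv.ofBijective (G.inrFibre hf x) (G.bijective_fibreInr x)
  have he : ∀ v h, e.symm ⟨Glue.inr G.lift v, h⟩ = ⟨v, Glue.inr_injective _ h⟩ := fun v h =>
    e.symm_apply_eq.mpr rfl
  refine ⟨⟨Glue.inr G.f x, φ.1 ∘ₗ e.symm.toLinearMap, dSmooth_of_inl_inr ?_ ?_⟩, rfl, ?_⟩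
  · intro k p hp h
    have hY : ∀ t, P₁.proj (p t) ∈ G.Y := fun t => (G.mem_of_glue_eq (h t)).1
    have hx : ∀ t, P₂.proj (G.lift ⟨p t, hY t⟩) = x := fun t =>
      (G.proj_lift _).trans (G.mem_of_glue_eq (h t)).2
    have h1 := φ.2 k (fun t => ⟨G.lift ⟨p t, hY t⟩, hx t⟩) (G.smooth_lift k (fun t => ⟨p t, hY t⟩) hp)
    refine contDiff_of_forall_eq h1.contDiff fun t => congrArg φ.1 ?_
    refine e.symm_apply_eq.mpr (Subtype.ext ?_)
    exact Glue.inl_eq_inr G.lift ⟨p t, hY t⟩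
  · intro k p hp h
    have h1 := φ.2 k (fun t => ⟨p t, Glue.inr_injective _ (h t)⟩) hp
    exact contDiff_of_forall_eq h1.contDiff fun t => congrArg φ.1 (he _ _)
  · refine Dual.ext_eval rfl fun v hv hv' => ?_
    exact congrArg φ.1 (he v _)

/-- Over `Y` a functional on `V₁` extends only if it factors through `f̃`, hence the surjectivity
assumption. Off `Y` it transports along `j₁`. -/
theorem Invertible.exists_restrictInl_eq (hG : G.Invertible)
    (hsurj : ∀ x, Function.Surjective (hG.dualMap x)) (r : P₁.Dual) :
    ∃ (d : (G.glue hG.injective).Dual) (h : Glue.inl G.f r.base = d.base),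
      restrictInl d r.base h = r := by
  by_cases hr : r.base ∈ G.Y
  · have h2 : ∃ r₂ : (P₂.dual.proj ⁻¹' Set.range G.f : Set P₂.Dual), hG.dualLift r₂ = r := by
      obtain ⟨y, ψ⟩ := r
      have key : ∀ (x : Set.range G.f) (y : G.Y), G.inv hG.injective x = y →
          ∀ ψ : SmoothDual (P₁.Fibre y), ∃ r₂, hG.dualLift r₂ = ⟨y, ψ⟩ := by
        rintro x _ rfl ψ
        obtain ⟨φ, rfl⟩ := hsurj x ψ
        exact ⟨⟨⟨x, φ⟩, x.2⟩, rfl⟩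
      exact key ⟨G.f ⟨y, hr⟩, _, rfl⟩ ⟨y, hr⟩ (G.inv_f _ _) ψ
    obtain ⟨⟨r₂, hr₂⟩, rfl⟩ := h2
    obtain ⟨d, hd, hdr⟩ := exists_restrictInr_eq hG.injective r₂
    have hb : Glue.inl G.f (G.inv hG.injective ⟨r₂.base, hr₂⟩) = d.base :=
      (Glue.inl_eq_inr G.f _).trans ((congrArg _ (G.f_inv hG.injective ⟨_, hr₂⟩)).trans hd)
    refine ⟨d, hb, ?_⟩
    exact (hG.dualLift_restrictInr d hb hd hr₂).symm.trans
      (congrArg hG.dualLift (Subtype.ext hdr))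
  · obtain ⟨x, φ⟩ := r
    let e := LinearEquiv.ofBijective (G.inlFibre hG.injective x) (G.bijective_fibreInl hr)
    have he : ∀ v h, e.symm ⟨Glue.inl G.lift v, h⟩ = ⟨v, G.eq_of_glue_eq hG.injective h⟩ :=
      fun v h => e.symm_apply_eq.mpr rfl
    refine ⟨⟨Glue.inl G.f x, φ.1 ∘ₗ e.symm.toLinearMap, dSmooth_of_inl_inr ?_ ?_⟩, rfl, ?_⟩
    · intro k p hp h
      have h1 := φ.2 k (fun t => ⟨p t, G.eq_of_glue_eq hG.injective (h t)⟩) hp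
      exact contDiff_of_forall_eq h1.contDiff fun t => congrArg φ.1 (he _ _)
    -- No vector of `V₂` lies over `i₁ x` when `x ∉ Y`, so there are no such plots; the parameter
    -- `0` already gives a contradiction.
    · intro k p hp h
      exact absurd (G.mem_of_glue_eq (h 0).symm).1 hr
    · refine Dual.ext_eval rfl fun v hv hv' => ?_
      exact congrArg φ.1 (he v _)

/-- A plot of `V₁` lying over the base of the family is over `Y`, and `f̃` carries it to a plot of
`V₂`, on which `r` evaluates smoothly. -/
theorem isPlot_of_restrictInr {n : ℕ} {r : Eucl n → P₂.Dual} (hr : IsPlot r)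
    {d : Eucl n → (G.glue hf).Dual} (hb : ∀ t, Glue.inr G.f (r t).base = (d t).base)
    (hd : ∀ t, restrictInr (d t) (r t).base (hb t) = r t) : IsPlot d := by
  refine isPlot_glueDual ?_ ?_ ?_
  · simp only [← hb]
    exact Glue.dSmooth_inr G.f _ _ hr.1
  · intro k a p ha hp h
    have h1 := fun t => G.mem_of_glue_eq ((h t).trans (hb (a t)).symm)
    have hx : ∀ t, P₂.proj (G.lift ⟨p t, (h1 t).1⟩) = (r (a t)).base := fun t =>
      (G.proj_lift _).trans (h1 t).2
    refine contDiff_of_forall_eq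
      (IsDualPlot.contDiff hr ha (G.smooth_lift k (fun t => ⟨p t, (h1 t).1⟩) hp) hx) fun t => ?_
    refine Eq.trans ?_ (eval_inr (d (a t)) (hd (a t)) (hx t)
      ((congrArg (Glue.inr G.f) (hx t)).trans (hb _)))
    exact Dual.eval_congr rfl (Glue.inl_eq_inr G.lift ⟨p t, (h1 t).1⟩) _ _
  · intro k a p ha hp h
    have hx : ∀ t, P₂.proj (p t) = (r (a t)).base := fun t =>
      Glue.inr_injective _ ((h t).trans (hb (a t)).symm)
    exact contDiff_of_forall_eq (IsDualPlot.contDiff hr ha hp hx) fun t => eval_inr _ (hd (a t)) (hx t) _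

/-- The extension to `V₂` of a functional on `V₁` written in terms of `g₁`. -/
theorem Invertible.eval_inr_eq_sum {hG : G.Invertible}
    (hinj : ∀ x, Function.Injective (hG.dualMap x))
    {g₁ : P₁.PseudoMetric} {g₂ : P₂.PseudoMetric} (hg : G.Compatible g₁ g₂)
    (d : (G.glue hG.injective).Dual) {r : P₁.Dual} {h : Glue.inl G.f r.base = d.base}
    (hr : restrictInl d r.base h = r) {n : ℕ} {a : Fin n → ℝ} {s : Fin n → P₁.Fibre r.base}
    (hs : r.functional.1 = ∑ i, a i • g₁.form _ (s i)) (y : r.base ∈ G.Y) {x : X₂}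
    (hy : G.f ⟨r.base, y⟩ = x) (v : P₂.Fibre x)
    (hv : (G.glue hG.injective).proj (Glue.inr G.lift v.1) = d.base) :
    d.eval (Glue.inr G.lift v.1) hv =
      ∑ i, a i * g₂.form x (G.fibreMap ⟨r.base, y⟩ x hy (s i)) v := by
  have hx : Glue.inr G.f x = d.base := by
    rw [← h, ← hy]
    exact (Glue.inl_eq_inr G.f ⟨r.base, y⟩).symm
  let φ : SmoothDual (P₂.Fibre x) := ⟨∑ i, a i • g₂.form x (G.fibreMap ⟨r.base, y⟩ x hy (s i)),
    Submodule.sum_mem _ fun i _ => Submodule.smul_mem _ _ ((g₂.isPseudoMetric x).apply_mem _)⟩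
  -- Injectivity of `f̃*` allows the comparison after pulling back to `V₁`, where compatibility
  -- turns the `g₂` sum into the given `g₁` sum.
  have key : (restrictInr d x hx).functional = φ := by
    refine hG.pullback_fibreMap_injective hinj ⟨r.base, y⟩ x hy (Subtype.ext ?_)
    refine LinearMap.ext fun w => ?_
    have h1 : r.functional.1 w = φ.1 (G.fibreMap ⟨r.base, y⟩ x hy w) := by
      rw [hs]
      simp only [φ, LinearMap.sum_apply, LinearMap.smul_apply]
      exact Finset.sum_congr rfl fun i _ =>
        congrArg (a i • ·) (hg.form_eq ⟨r.base, y⟩ x hy (s i) w)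
    refine Eq.trans ?_ h1
    refine Eq.trans ?_ (eval_inl d hr w.2 ((congrArg (Glue.inl G.f) w.2).trans h))
    exact Dual.eval_congr rfl (Glue.inl_eq_inr G.lift ⟨w.1, mem_of_fibre w y⟩).symm _ _
  have h1 : d.eval (Glue.inr G.lift v.1) hv = φ.1 v := by
    rw [← key]
    rfl
  rw [h1]
  simp only [φ, LinearMap.sum_apply, LinearMap.smul_apply, smul_eq_mul]

/-- Plots of `V₂` cannot be pulled back through `f̃`. Instead `r` is expanded locally through `g₁`,
and the expansion is pushed forward by `f̃` and paired through `g₂`. -/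
theorem Invertible.isPlot_of_restrictInl (hfd₁ : P₁.FiniteDim) (hlt₁ : P₁.LocallyTrivial)
    {hG : G.Invertible} (hinj : ∀ x, Function.Injective (hG.dualMap x))
    {g₁ : P₁.PseudoMetric} {g₂ : P₂.PseudoMetric} (hg : G.Compatible g₁ g₂)
    {n : ℕ} {r : Eucl n → P₁.Dual} (hr : IsPlot r)
    {d : Eucl n → (G.glue hG.injective).Dual} (hb : ∀ t, Glue.inl G.f (r t).base = (d t).base)
    (hd : ∀ t, restrictInl (d t) (r t).base (hb t) = r t) : IsPlot d := by
  refine isPlot_glueDual ?_ ?_ ?_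
  · simp only [← hb]
    exact Glue.dSmooth_inl G.f _ _ hr.1
  · intro k a p ha hp h
    have hx : ∀ t, P₁.proj (p t) = (r (a t)).base := fun t =>
      G.eq_of_glue_eq hG.injective ((h t).trans (hb (a t)).symm)
    exact contDiff_of_forall_eq (IsDualPlot.contDiff hr ha hp hx) fun t => eval_inl _ (hd (a t)) (hx t) _
  · intro k a p ha hp h
    have hY := fun t => G.mem_of_glue_eq ((hb (a t)).trans (h t).symm)
    refine contDiff_iff_contDiffAt.mpr fun t₀ => ?_
    obtain ⟨κ, hκ, hκt, m, s, c, hs, hc, hrs⟩ :=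
      g₁.exists_local_lift hfd₁ hlt₁ (isPlot_reparam hr ha) t₀
    have hsmooth : ContDiffAt ℝ ∞ (fun t => ∑ i, c i t * g₂.form (P₂.proj (p (κ t)))
        (G.fibreMap ⟨(r (a (κ t))).base, (hY (κ t)).1⟩ _ (hY (κ t)).2 (s i t))
        ⟨p (κ t), rfl⟩) t₀ :=
      ContDiffAt.sum fun i _ => (hc i).mul (g₂.contDiff_form
        (v := fun t => G.fibreMap ⟨(r (a (κ t))).base, (hY (κ t)).1⟩ _ (hY (κ t)).2 (s i t))
        (w := fun t => ⟨p (κ t), rfl⟩)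
        (G.smooth_lift k (fun t => ⟨(s i t).1, mem_of_fibre (s i t) (hY (κ t)).1⟩) (hs i))
        (isPlot_reparam hp hκ)).contDiffAt
    refine hsmooth.congr_of_eventuallyEq ?_
    filter_upwards [hκt, hrs] with t ht hrst
    refine Eq.trans ?_ (hG.eval_inr_eq_sum hinj hg (d (a (κ t))) (hd (a (κ t))) hrst
      (hY (κ t)).1 (hY (κ t)).2 ⟨p (κ t), rfl⟩ (h (κ t)))
    exact Dual.eval_congr (by rw [ht]) (by rw [ht]) _ _

/-! ### The commutativity map -/

open Classical in
/-- The map `(V₁ ∪_f̃ V₂)* → V₂* ∪_f̃* V₁*` that restricts functionals to the terms. -/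
noncomputable def Invertible.commFun (hG : G.Invertible) (d : (G.glue hG.injective).Dual) :
    Glue hG.dualGluing.lift :=
  -- The left term of the target is `V₂*`, so `inl` and `inr` trade places. Over `i₂(f(Y))` the
  -- restriction to `V₂` is preferred.
  if h : ∃ x, Glue.inr G.f x = d.base then
    Glue.inl hG.dualGluing.lift (restrictInr d h.choose h.choose_spec)
  else
    Glue.inr hG.dualGluing.lift (restrictInl d _
      ((Glue.inr_or_inl G.f d.base).resolve_left h).choose_spec.2)

theorem Invertible.commFun_inr (hG : G.Invertible) (d : (G.glue hG.injective).Dual) {x : X₂}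
    (h : Glue.inr G.f x = d.base) :
    hG.commFun d = Glue.inl hG.dualGluing.lift (restrictInr d x h) := by
  have h' : ∃ x, Glue.inr G.f x = d.base := ⟨x, h⟩
  have key : ∀ x' (hx' : Glue.inr G.f x' = d.base), x' = x →
      restrictInr d x' hx' = restrictInr d x h := by
    rintro x' hx' rfl
    rfl
  rw [Invertible.commFun, dif_pos h',
    key _ h'.choose_spec (Glue.inr_injective _ (h'.choose_spec.trans h.symm))]

/-- Valid over `Y` too: there the value built from `V₂*` is glued to its image under `f̃*`, which is
the restriction to `V₁`. -/
theorem Invertible.commFun_inl (hG : G.Invertible) (d : (G.glue hG.injective).Dual) {x : X₁}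
    (h : Glue.inl G.f x = d.base) :
    hG.commFun d = Glue.inr hG.dualGluing.lift (restrictInl d x h) := by
  by_cases h' : ∃ x, Glue.inr G.f x = d.base
  · obtain ⟨x', hx'⟩ := h'
    obtain ⟨hx, hxx'⟩ := G.mem_of_glue_eq (h.trans hx'.symm)
    have hr : x' ∈ Set.range G.f := ⟨_, hxx'⟩
    rw [hG.commFun_inr d hx', ← hG.dualLift_restrictInr d h hx' hr]
    exact Glue.inl_eq_inr hG.dualGluing.lift ⟨restrictInr d x' hx', hr⟩
  · have key : ∀ x' (hx' : Glue.inl G.f x' = d.base), x' = x →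
        restrictInl d x' hx' = restrictInl d x h := by
      rintro x' hx' rfl
      rfl
    rw [Invertible.commFun, dif_neg h', key _ _ (G.eq_of_glue_eq hG.injective
      (((Glue.inr_or_inl G.f d.base).resolve_left h').choose_spec.2.trans h.symm))]

/-- Locally the base of the plot lifts to `X₁` or to `X₂`. The restricted functionals evaluate on
plots of that term as the original ones do on their images under `j₁` or `j₂`. -/
theorem Invertible.dSmooth_commFun (hG : G.Invertible) : DSmooth hG.commFun := by
  intro n q hq
  refine isPlot_of_eventuallyEq fun t₀ => ?_
  obtain ⟨κ, hκ, hκt, ⟨b, hb, h⟩ | ⟨b, hb, h⟩⟩ := Glue.exists_lift_reparam _ hq.1 t₀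
  · refine ⟨_, Glue.dSmooth_inr hG.dualGluing.lift _
      (fun t => restrictInl (q (κ t)) (b t) (h t).symm)
      (isDualPlot_of_contDiff hb fun k a p ha hp hpa => ?_), ?_⟩
    · exact IsDualPlot.contDiff hq (hκ.comp ha) (Glue.dSmooth_inl G.lift _ _ hp)
        (fun t => (congrArg (Glue.inl G.f) (hpa t)).trans (h (a t)).symm)
    · filter_upwards [hκt] with t ht
      refine Eq.trans ?_ (hG.commFun_inl (q (κ t)) (h t).symm)
      rw [ht]
      rfl
  · refine ⟨_, Glue.dSmooth_inl hG.dualGluing.lift _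
      (fun t => restrictInr (q (κ t)) (b t) (h t).symm)
      (isDualPlot_of_contDiff hb fun k a p ha hp hpa => ?_), ?_⟩
    · exact IsDualPlot.contDiff hq (hκ.comp ha) (Glue.dSmooth_inr G.lift _ _ hp)
        (fun t => (congrArg (Glue.inr G.f) (hpa t)).trans (h (a t)).symm)
    · filter_upwards [hκt] with t ht
      refine Eq.trans ?_ (hG.commFun_inr (q (κ t)) (h t).symm)
      rw [ht]
      rfl

theorem Invertible.injective_commFun (hG : G.Invertible)
    (hinj : ∀ x, Function.Injective (hG.dualMap x)) : Function.Injective hG.commFun := by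
  -- Injective `f⁻¹` separates base points and injective `f̃*` separates functionals, so `V₂*`
  -- embeds in the glued dual.
  have hlift : Function.Injective hG.dualLift := by
    rintro ⟨⟨x, φ⟩, hx⟩ ⟨⟨x', φ'⟩, hx'⟩ h
    obtain rfl : x = x' := congrArg Subtype.val
      (hG.dualGluing_injective (a₁ := ⟨x, hx⟩) (a₂ := ⟨x', hx'⟩) (congrArg Dual.base h))
    have h1 : hG.dualMap ⟨x, hx⟩ φ = hG.dualMap ⟨x, hx⟩ φ' := by
      injection h
    obtain rfl := hinj _ h1
    rfl
  -- The mixed case is impossible: a value coming from both terms lies over some `x' = f⁻¹(x)`,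
  -- which is in `Y`.
  have hne : ∀ d d' : (G.glue hG.injective).Dual, hG.commFun d = hG.commFun d' →
      ∀ (x : X₂) (x' : X₁), x' ∉ G.Y → Glue.inr G.f x = d.base → Glue.inl G.f x' ≠ d'.base := by
    intro d d' h x x' hx' hx hd'
    rw [hG.commFun_inr d hx, hG.commFun_inl d' hd'] at h
    have h1 : Glue.inl hG.dualGluing.f x = Glue.inr hG.dualGluing.f x' :=
      congrArg hG.dualGluing.glueProj h
    obtain ⟨hxY, h2⟩ := hG.dualGluing.mem_of_glue_eq h1
    exact hx' (h2 ▸ (G.inv hG.injective ⟨x, hxY⟩).2)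
  intro d d' h
  rcases Glue.inr_or_inl G.f d.base with ⟨x, hx⟩ | ⟨x, hxY, hx⟩ <;>
  rcases Glue.inr_or_inl G.f d'.base with ⟨x', hx'⟩ | ⟨x', hxY', hx'⟩
  · rw [hG.commFun_inr d hx, hG.commFun_inr d' hx'] at h
    have h1 := Glue.inl_injective (f := hG.dualGluing.lift) hlift h
    obtain rfl : x = x' := congrArg Dual.base h1
    exact eq_of_restrictInr hx hx' h1
  · exact absurd hx' (hne d d' h x x' hxY' hx)
  · exact absurd hx (hne d' d h.symm x' x hxY hx')
  · rw [hG.commFun_inl d hx, hG.commFun_inl d' hx'] at h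
    have h1 := Glue.inr_injective _ h
    obtain rfl : x = x' := congrArg Dual.base h1
    exact eq_of_restrictInl hxY hx hx' h1

theorem Invertible.surjective_commFun (hG : G.Invertible)
    (hsurj : ∀ x, Function.Surjective (hG.dualMap x)) : Function.Surjective hG.commFun := by
  intro e
  induction e using Quot.ind with
  | mk e =>
    rcases e with r | r
    · obtain ⟨d, h, hd⟩ := exists_restrictInr_eq hG.injective r
      exact ⟨d, (hG.commFun_inr d h).trans (congrArg _ hd)⟩
    · obtain ⟨d, h, hd⟩ := hG.exists_restrictInl_eq hsurj r
      exact ⟨d, (hG.commFun_inl d h).trans (congrArg _ hd)⟩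

theorem Invertible.proj_commFun (hG : G.Invertible) (d : (G.glue hG.injective).Dual) :
    hG.dualGlue.proj (hG.commFun d) = hG.switch d.base := by
  rcases Glue.inr_or_inl G.f d.base with ⟨x, h⟩ | ⟨x, -, h⟩
  · rw [hG.commFun_inr d h, ← h]
    rfl
  · rw [hG.commFun_inl d h, ← h]
    rfl

theorem Invertible.dSmooth_commFun_symm (hfd₁ : P₁.FiniteDim) (hlt₁ : P₁.LocallyTrivial)
    (hG : G.Invertible) (hbij : ∀ x, Function.Bijective (hG.dualMap x))
    {g₁ : P₁.PseudoMetric} {g₂ : P₂.PseudoMetric} (hg : G.Compatible g₁ g₂)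
    (hΦ : Function.Bijective hG.commFun) : DSmooth (Equiv.ofBijective hG.commFun hΦ).symm := by
  intro n q hq
  refine isPlot_of_eventuallyEq fun t₀ => ?_
  rcases Glue.exists_lift _ hq t₀ with ⟨r, hr, h⟩ | ⟨r, hr, h⟩
  -- An arbitrary pointwise choice is harmless: any family whose restrictions form the plot `r` is
  -- itself a plot.
  · choose d hb hd using fun t => exists_restrictInr_eq hG.injective (r t)
    refine ⟨d, isPlot_of_restrictInr hr hb hd, ?_⟩
    filter_upwards [h] with t ht
    refine (Equiv.symm_apply_eq _).mpr (ht.trans ?_)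
    exact ((hG.commFun_inr (d t) (hb t)).trans (congrArg _ (hd t))).symm
  · choose d hb hd using fun t => hG.exists_restrictInl_eq (fun x => (hbij x).2) (r t)
    refine ⟨d, Invertible.isPlot_of_restrictInl hfd₁ hlt₁ (fun x => (hbij x).1) hg hr hb hd, ?_⟩
    filter_upwards [h] with t ht
    refine (Equiv.symm_apply_eq _).mpr (ht.trans ?_)
    exact ((hG.commFun_inl (d t) (hb t)).trans (congrArg _ (hd t))).symm

end Gluing

end PseudoBundle
-- The gluing-dual commutativity theorem.
theorem mainTheorem1 {V₁ X₁ V₂ X₂ : Type*} [DiffeologicalSpace V₁] [DiffeologicalSpace X₁]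
    [DiffeologicalSpace V₂] [DiffeologicalSpace X₂]
    (P₁ : PseudoBundle V₁ X₁) (P₂ : PseudoBundle V₂ X₂)
    (hfd₁ : P₁.FiniteDim) (hfd₂ : P₂.FiniteDim)
    (hlt₁ : P₁.LocallyTrivial) (hlt₂ : P₂.LocallyTrivial)
    (G : P₁.Gluing P₂) (hG : G.Invertible)
    (g₁ : P₁.PseudoMetric) (g₂ : P₂.PseudoMetric)
    (hg : G.Compatible g₁ g₂) (hg' : hG.DualCompatible g₁ g₂) :
    hG.GluingDualCommutativity := by
  have hbij : ∀ x, Function.Bijective (hG.dualMap x) := fun x =>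
    ⟨hg'.injective_dualMap hfd₂ x, hg.surjective_dualMap hfd₁ hG x⟩
  have hΦ : Function.Bijective hG.commFun :=
    ⟨hG.injective_commFun fun x => (hbij x).1, hG.surjective_commFun fun x => (hbij x).2⟩
  refine ⟨Equiv.ofBijective hG.commFun hΦ, hG.dSmooth_commFun,
    hG.dSmooth_commFun_symm hfd₁ hlt₁ hbij hg hΦ, hG.proj_commFun,
    fun x _ φ => hG.commFun_inl ⟨Glue.inl G.f x, φ⟩ rfl, fun x hx φ => ?_,
    fun x _ φ => hG.commFun_inr ⟨Glue.inr G.f x, φ⟩ rfl⟩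
  -- Over `f(Y)` the map yields an element of `V₂*`; the gluing relation of the target rewrites it
  -- as its image under `f̃*`.
  exact (hG.commFun_inr ⟨Glue.inr G.f x, φ⟩ rfl).trans
    (Glue.inl_eq_inr hG.dualGluing.lift ⟨_, hx⟩)
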